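/- **Weak quantum de Finetti theorem.** Let $\mathfrak H$ be a separable complex Hilbert space. For $n\ge 0$ let $\mathfrak H^n=\bigotimes_{\rm sym}^n\mathfrak H$ be the symmetric subspace of the Hilbert space tensor power $\mathfrak H^{\otimes n}$ (with $\mathfrak H^0=\mathbb C$), and let $\mathfrak S^1(\mathfrak H^n)$ denote the trace class operators on $\mathfrak H^n$. Let $(\Gamma_N)_{N\in\mathbb N}$ be a sequence of bosonic states, i.e. $\Gamma_N\in\mathfrak S^1(\mathfrak H^N)$ is positive (in particular self-adjoint) with $\operatorname{Tr}\Gamma_N=1$. For $N\ge k$ let $\gamma_N^{(k)}=\operatorname{Tr}_{k+1\to N}[\Gamma_N]$, an operator on $\mathfrak H^k$, be its $k$-body reduced density matrix, that is, the partial trace of $\Gamma_N$ over $N-k$ of the $N$ tensor factors (so $\operatorname{Tr}\gamma_N^{(k)}=1$). Assume that for every $k\in\mathbb N$ there is $\gamma^{(k)}\in\mathfrak S^1(\mathfrak H^k)$ such that $$\gamma_N^{(k)}\rightharpoonup_*\gamma^{(k)}\quad\text{in }\mathfrak S^1(\mathfrak H^k)\text{ as }N\to\infty,$$ i.e. $\operatorname{Tr}[\gamma_N^{(k)}K]\to\operatorname{Tr}[\gamma^{(k)}K]$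 for every compact operator $K$ on $\mathfrak H^k$. Then there exists a unique Borel probability measure $\mu$ on the unit ball $B\mathfrak H=\{u\in\mathfrak H:\|u\|\le 1\}$, invariant under the action $u\mapsto e^{i\theta}u$ of $S^1$, such that $$\gamma^{(k)}=\int_{B\mathfrak H}|u^{\otimes k}\rangle\langle u^{\otimes k}|\,d\mu(u)\qquad\text{for all }k\ge 0 .$$ -/

import Mathlib

open Filter Topology MeasureTheory
open scoped TensorProduct InnerProductSpace ComplexConjugate

noncomputable section

namespace DeFinetti

/-! ### Hilbert tensor powers -/

/-- The algebraic tensor power `H ⊗ ⋯ ⊗ H` (`n` factors). It is a type synonym of Mathlib's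
`⨂[ℂ] _ : Fin n, H`, because the latter carries the injective seminorm, whereas here we use
the Hilbert space inner product. -/
def AlgTensorPower (H : Type*) [NormedAddCommGroup H] [InnerProductSpace ℂ H] (n : ℕ) : Type _ :=
  ⨂[ℂ] _ : Fin n, H

section Algebraic

variable {H : Type*} [NormedAddCommGroup H] [InnerProductSpace ℂ H] {n : ℕ}

instance : AddCommGroup (AlgTensorPower H n) :=
  inferInstanceAs (AddCommGroup (⨂[ℂ] _ : Fin n, H))

instance : Module ℂ (AlgTensorPower H n) :=
  inferInstanceAs (Module ℂ (⨂[ℂ] _ : Fin n, H))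

/-- The pure tensor `v₁ ⊗ ⋯ ⊗ vₙ`. -/
def algTprod (v : Fin n → H) : AlgTensorPower H n := PiTensorProduct.tprod ℂ v

/-- The linear functional `y ↦ ⟨v₁ ⊗ ⋯ ⊗ vₙ, y⟩`. -/
def pairing (v : Fin n → H) : AlgTensorPower H n →ₗ[ℂ] ℂ :=
  PiTensorProduct.lift
    ((MultilinearMap.mkPiAlgebra ℂ (Fin n) ℂ).compLinearMap fun i => innerₛₗ ℂ (v i))

theorem pairing_algTprod (v w : Fin n → H) :
    pairing v (algTprod w) = ∏ i, ⟪v i, w i⟫_ℂ := by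
  unfold pairing algTprod
  erw [PiTensorProduct.lift.tprod]
  simp

theorem algTensor_ext {E : Type*} [AddCommMonoid E] [Module ℂ E]
    {f g : AlgTensorPower H n →ₗ[ℂ] E} (h : ∀ v, f (algTprod v) = g (algTprod v)) : f = g :=
  PiTensorProduct.ext (R := ℂ) (s := fun _ : Fin n => H) (MultilinearMap.ext h)

theorem prod_update_add (v w : Fin n → H) (i : Fin n) (a b : H) :
    ∏ j, ⟪Function.update v i (a + b) j, w j⟫_ℂ
      = ∏ j, ⟪Function.update v i a j, w j⟫_ℂ + ∏ j, ⟪Function.update v i b j, w j⟫_ℂ := by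
  have key : ∀ c : H, ∏ j, ⟪Function.update v i c j, w j⟫_ℂ
      = ⟪c, w i⟫_ℂ * ∏ j ∈ Finset.univ.erase i, ⟪v j, w j⟫_ℂ := by
    intro c
    rw [← Finset.mul_prod_erase _ _ (Finset.mem_univ i)]
    congr 1
    · simp
    · refine Finset.prod_congr rfl fun j hj => ?_
      rw [Function.update_of_ne (Finset.ne_of_mem_erase hj)]
  rw [key, key, key, inner_add_left, add_mul]

theorem prod_update_smul (v w : Fin n → H) (i : Fin n) (c : ℂ) (a : H) :
    ∏ j, ⟪Function.update v i (c • a) j, w j⟫_ℂ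
      = conj c * ∏ j, ⟪Function.update v i a j, w j⟫_ℂ := by
  have key : ∀ c : H, ∏ j, ⟪Function.update v i c j, w j⟫_ℂ
      = ⟪c, w i⟫_ℂ * ∏ j ∈ Finset.univ.erase i, ⟪v j, w j⟫_ℂ := by
    intro c
    rw [← Finset.mul_prod_erase _ _ (Finset.mem_univ i)]
    congr 1
    · simp
    · refine Finset.prod_congr rfl fun j hj => ?_
      rw [Function.update_of_ne (Finset.ne_of_mem_erase hj)]
  rw [key, key, inner_smul_left, mul_assoc]

theorem pairing_update_add (v : Fin n → H) (i : Fin n) (a b : H) :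
    pairing (Function.update v i (a + b))
      = pairing (Function.update v i a) + pairing (Function.update v i b) :=
  algTensor_ext fun w => by
    simp only [LinearMap.add_apply, pairing_algTprod, prod_update_add]

theorem pairing_update_smul (v : Fin n → H) (i : Fin n) (c : ℂ) (a : H) :
    pairing (Function.update v i (c • a)) = conj c • pairing (Function.update v i a) :=
  algTensor_ext fun w => by
    simp only [LinearMap.smul_apply, pairing_algTprod, prod_update_smul, smul_eq_mul]

/-- The linear functional `x ↦ ⟨y, x⟩`, defined on pure tensors `x = v₁ ⊗ ⋯ ⊗ vₙ` as the
complex conjugate of `⟨v₁ ⊗ ⋯ ⊗ vₙ, y⟩`. -/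
def conjPairing (y : AlgTensorPower H n) : AlgTensorPower H n →ₗ[ℂ] ℂ :=
  PiTensorProduct.lift
    { toFun := fun v => conj (pairing v y)
      map_update_add' := by
        intro inst v i a b
        obtain rfl : inst = instDecidableEqFin n := Subsingleton.elim _ _
        rw [pairing_update_add, LinearMap.add_apply, map_add]
      map_update_smul' := by
        intro inst v i c a
        obtain rfl : inst = instDecidableEqFin n := Subsingleton.elim _ _
        rw [pairing_update_smul, LinearMap.smul_apply, smul_eq_mul, map_mul, Complex.conj_conj,
          smul_eq_mul] }

theorem conjPairing_algTprod (y : AlgTensorPower H n) (v : Fin n → H) :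
    conjPairing y (algTprod v) = conj (pairing v y) := by
  unfold conjPairing algTprod
  erw [PiTensorProduct.lift.tprod]
  rfl

theorem conjPairing_add (y z : AlgTensorPower H n) :
    conjPairing (y + z) = conjPairing y + conjPairing z :=
  algTensor_ext fun v => by
    simp only [LinearMap.add_apply, conjPairing_algTprod, map_add]

theorem conjPairing_smul (c : ℂ) (y : AlgTensorPower H n) :
    conjPairing (c • y) = conj c • conjPairing y :=
  algTensor_ext fun v => by
    simp only [LinearMap.smul_apply, conjPairing_algTprod, map_smul, smul_eq_mul, map_mul]

/-- The sesquilinear form on the algebraic tensor power (conjugate linear on the left) with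
`⟨v₁ ⊗ ⋯ ⊗ vₙ, w₁ ⊗ ⋯ ⊗ wₙ⟩ = ∏ᵢ ⟨vᵢ, wᵢ⟩`. -/
def form : AlgTensorPower H n →ₗ⋆[ℂ] AlgTensorPower H n →ₗ[ℂ] ℂ where
  toFun := conjPairing
  map_add' := conjPairing_add
  map_smul' := conjPairing_smul

theorem form_algTprod (v w : Fin n → H) :
    form (algTprod v) (algTprod w) = ∏ i, ⟪v i, w i⟫_ℂ := by
  change conjPairing (algTprod v) (algTprod w) = _
  rw [conjPairing_algTprod, pairing_algTprod, map_prod]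
  exact Finset.prod_congr rfl fun i _ => inner_conj_symm _ _

theorem exists_sum_algTprod (x : AlgTensorPower H n) :
    ∃ c : (Fin n → H) →₀ ℂ, x = c.sum fun v a => a • algTprod v := by
  have hx : x ∈ Submodule.span ℂ (Set.range (algTprod (H := H) (n := n))) := by
    have := PiTensorProduct.span_tprod_eq_top (R := ℂ) (s := fun _ : Fin n => H)
    exact (this ▸ Submodule.mem_top : (x : ⨂[ℂ] _ : Fin n, H) ∈ _)
  obtain ⟨c, hc⟩ := Finsupp.mem_span_range_iff_exists_finsupp.mp hx
  exact ⟨c, hc.symm⟩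

theorem form_sum (c d : (Fin n → H) →₀ ℂ) :
    form (c.sum fun v a => a • algTprod v) (d.sum fun w b => b • algTprod w)
      = c.sum fun v a => d.sum fun w b => star a * (∏ i, ⟪v i, w i⟫_ℂ) * b := by
  simp only [Finsupp.sum, map_sum, LinearMap.sum_apply, map_smulₛₗ, LinearMap.smul_apply,
    form_algTprod, smul_eq_mul, RingHom.id_apply, Complex.star_def]
  simp only [Finset.mul_sum]
  rw [Finset.sum_comm]
  exact Finset.sum_congr rfl fun v _ => Finset.sum_congr rfl fun w _ => by ring

open scoped ComplexOrder in
theorem posSemidef_inner (H : Type*) [NormedAddCommGroup H] [InnerProductSpace ℂ H]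
    {X : Type*} (f : X → H) :
    (Matrix.of fun v w : X => ⟪f v, f w⟫_ℂ).PosSemidef := by
  refine ⟨Matrix.ext fun v w => inner_conj_symm _ _, fun c => ?_⟩
  have : (c.sum fun v a => c.sum fun w b =>
      star a * (Matrix.of fun v w : X => ⟪f v, f w⟫_ℂ) v w * b)
      = ⟪c.sum fun v a => a • f v, c.sum fun v a => a • f v⟫_ℂ := by
    simp only [Finsupp.sum, sum_inner, inner_sum, inner_smul_left, inner_smul_right,
      Matrix.of_apply, Complex.star_def, Finset.mul_sum]
    rw [Finset.sum_comm]
    exact Finset.sum_congr rfl fun v _ => Finset.sum_congr rfl fun w _ => by ring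
  rw [this, inner_self_eq_norm_sq_to_K, ← RCLike.ofReal_pow]
  exact Complex.zero_le_real.mpr (sq_nonneg _)

open scoped ComplexOrder in
theorem posSemidef_prod (s : Finset (Fin n)) :
    (Matrix.of fun v w : Fin n → H => ∏ i ∈ s, ⟪v i, w i⟫_ℂ).PosSemidef := by
  classical
  induction s using Finset.induction_on with
  | empty => simpa using posSemidef_inner ℂ (fun _ : Fin n → H => (1 : ℂ))
  | insert i s hi ih =>
    have h := (posSemidef_inner H (fun v : Fin n → H => v i)).hadamard ih
    have e : (Matrix.of fun v w : Fin n → H => ∏ j ∈ insert i s, ⟪v j, w j⟫_ℂ)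
        = (Matrix.of fun v w : Fin n → H => ⟪v i, w i⟫_ℂ).hadamard
          (Matrix.of fun v w : Fin n → H => ∏ j ∈ s, ⟪v j, w j⟫_ℂ) := by
      ext v w
      exact Finset.prod_insert hi
    rw [e]
    exact h

/-- The inner product on the algebraic tensor power. -/
@[reducible] def preCore : PreInnerProductSpace.Core ℂ (AlgTensorPower H n) where
  inner x y := form x y
  conj_inner_symm x y := by
    obtain ⟨c, rfl⟩ := exists_sum_algTprod x
    obtain ⟨d, rfl⟩ := exists_sum_algTprod y
    rw [form_sum, form_sum]
    simp only [Finsupp.sum, map_sum, map_mul, map_prod, inner_conj_symm, Complex.star_def,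
      Complex.conj_conj]
    rw [Finset.sum_comm]
    exact Finset.sum_congr rfl fun v _ => Finset.sum_congr rfl fun w _ => by ring
  re_inner_nonneg x := by
    obtain ⟨c, rfl⟩ := exists_sum_algTprod x
    rw [form_sum]
    exact (Complex.le_def.mp ((posSemidef_prod Finset.univ).2 c)).1
  add_left x y z := by simp
  smul_left x y r := by simp

instance : SeminormedAddCommGroup (AlgTensorPower H n) :=
  @InnerProductSpace.Core.toSeminormedAddCommGroup ℂ _ _ _ _ preCore

instance : InnerProductSpace ℂ (AlgTensorPower H n) := InnerProductSpace.ofCore preCore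

theorem inner_algTprod (v w : Fin n → H) :
    ⟪algTprod v, algTprod w⟫_ℂ = ∏ i, ⟪v i, w i⟫_ℂ := form_algTprod v w

theorem inner_eq_of_algTprod {m : ℕ} (f : AlgTensorPower H n →ₗ[ℂ] AlgTensorPower H m) (c : ℂ)
    (h : ∀ v w, ⟪f (algTprod v), f (algTprod w)⟫_ℂ = c * ⟪algTprod v, algTprod w⟫_ℂ)
    (x y : AlgTensorPower H n) : ⟪f x, f y⟫_ℂ = c * ⟪x, y⟫_ℂ := by
  obtain ⟨a, rfl⟩ := exists_sum_algTprod x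
  obtain ⟨b, rfl⟩ := exists_sum_algTprod y
  simp only [Finsupp.sum, map_sum, map_smul, sum_inner, inner_sum, inner_smul_left,
    inner_smul_right, h, Finset.mul_sum]
  exact Finset.sum_congr rfl fun v _ => Finset.sum_congr rfl fun w _ => by ring

/-- Permutation of the tensor factors on the algebraic tensor power. -/
def algPermute (σ : Equiv.Perm (Fin n)) : AlgTensorPower H n →ₗ[ℂ] AlgTensorPower H n :=
  (PiTensorProduct.reindex ℂ (fun _ : Fin n => H) σ).toLinearMap

theorem algPermute_algTprod (σ : Equiv.Perm (Fin n)) (v : Fin n → H) :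
    algPermute σ (algTprod v) = algTprod fun i => v (σ.symm i) :=
  PiTensorProduct.reindex_tprod σ v

/-- The linear map `x ↦ x ⊗ v₁ ⊗ ⋯ ⊗ vₘ` on the algebraic tensor power. -/
def algAppend (k : ℕ) {m : ℕ} (v : Fin m → H) :
    AlgTensorPower H k →ₗ[ℂ] AlgTensorPower H (k + m) :=
  (TensorPower.mulEquiv (R := ℂ) (M := H) (n := k) (m := m)).toLinearMap ∘ₗ
    (TensorProduct.mk ℂ (⨂[ℂ]^k H) (⨂[ℂ]^m H)).flip (PiTensorProduct.tprod ℂ v)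

theorem algAppend_algTprod (k : ℕ) {m : ℕ} (w : Fin k → H) (v : Fin m → H) :
    algAppend k v (algTprod w) = algTprod (Fin.append w v) :=
  TensorPower.tprod_mul_tprod ℂ w v

theorem norm_algPermute (σ : Equiv.Perm (Fin n)) (x : AlgTensorPower H n) :
    ‖algPermute σ x‖ ≤ 1 * ‖x‖ := by
  have h := inner_eq_of_algTprod (algPermute σ) 1 (fun v w => by
    rw [algPermute_algTprod, algPermute_algTprod, inner_algTprod, inner_algTprod, one_mul]
    exact Equiv.prod_comp σ.symm fun i => ⟪v i, w i⟫_ℂ) x x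
  rw [one_mul] at h ⊢
  rw [@norm_eq_sqrt_re_inner ℂ, @norm_eq_sqrt_re_inner ℂ _ _ _ _ x, h]

theorem norm_algAppend (k : ℕ) {m : ℕ} (v : Fin m → H) (x : AlgTensorPower H k) :
    ‖algAppend k v x‖ ≤ (∏ i, ‖v i‖) * ‖x‖ := by
  have h := inner_eq_of_algTprod (algAppend k v) (((∏ i, ‖v i‖) ^ 2 : ℝ) : ℂ) (fun w w' => by
    rw [algAppend_algTprod, algAppend_algTprod, inner_algTprod, inner_algTprod,
      Fin.prod_univ_add, mul_comm]
    simp only [Fin.append_left, Fin.append_right, inner_self_eq_norm_sq_to_K]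
    simp [Finset.prod_pow]) x x
  have h0 : 0 ≤ ∏ i, ‖v i‖ := Finset.prod_nonneg fun i _ => norm_nonneg _
  rw [@norm_eq_sqrt_re_inner ℂ, @norm_eq_sqrt_re_inner ℂ _ _ _ _ x, h]
  have : RCLike.re ((((∏ i, ‖v i‖) ^ 2 : ℝ) : ℂ) * ⟪x, x⟫_ℂ)
      = (∏ i, ‖v i‖) ^ 2 * RCLike.re ⟪x, x⟫_ℂ := Complex.re_ofReal_mul _ _
  rw [this, Real.sqrt_mul (sq_nonneg _), Real.sqrt_sq h0]

end Algebraic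

/-- The Hilbert tensor power of `H` (`n` factors): the Hilbert space completion of the algebraic
tensor power. -/
def TensorPow (H : Type*) [NormedAddCommGroup H] [InnerProductSpace ℂ H] (n : ℕ) : Type _ :=
  UniformSpace.Completion (AlgTensorPower H n)

section Hilbert

variable {H : Type*} [NormedAddCommGroup H] [InnerProductSpace ℂ H]

instance (n : ℕ) : NormedAddCommGroup (TensorPow H n) :=
  inferInstanceAs (NormedAddCommGroup (UniformSpace.Completion (AlgTensorPower H n)))

instance (n : ℕ) : InnerProductSpace ℂ (TensorPow H n) :=
  inferInstanceAs (InnerProductSpace ℂ (UniformSpace.Completion (AlgTensorPower H n)))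

instance (n : ℕ) : CompleteSpace (TensorPow H n) :=
  inferInstanceAs (CompleteSpace (UniformSpace.Completion (AlgTensorPower H n)))

/-- The pure tensor `v₁ ⊗ ⋯ ⊗ vₙ` in the Hilbert tensor power. -/
def tprod {n : ℕ} (v : Fin n → H) : TensorPow H n :=
  ((algTprod v : AlgTensorPower H n) : UniformSpace.Completion (AlgTensorPower H n))

theorem inner_tprod {n : ℕ} (v w : Fin n → H) :
    ⟪tprod v, tprod w⟫_ℂ = ∏ i, ⟪v i, w i⟫_ℂ :=
  (UniformSpace.Completion.inner_coe _ _).trans (inner_algTprod v w)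

/-- The operator permuting the tensor factors,
`v₁ ⊗ ⋯ ⊗ vₙ ↦ v_{σ⁻¹(1)} ⊗ ⋯ ⊗ v_{σ⁻¹(n)}`. -/
def permute {n : ℕ} (σ : Equiv.Perm (Fin n)) : TensorPow H n →L[ℂ] TensorPow H n :=
  ((algPermute σ).mkContinuous 1 (norm_algPermute σ)).completion

theorem permute_tprod {n : ℕ} (σ : Equiv.Perm (Fin n)) (v : Fin n → H) :
    permute σ (tprod v) = tprod fun i => v (σ.symm i) :=
  (ContinuousLinearMap.completion_apply_coe _ _).trans
    (congrArg _ (algPermute_algTprod σ v))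

/-- The operator `x ↦ x ⊗ v₁ ⊗ ⋯ ⊗ vₘ` between Hilbert tensor powers. -/
def append (k : ℕ) {m : ℕ} (v : Fin m → H) : TensorPow H k →L[ℂ] TensorPow H (k + m) :=
  ((algAppend k v).mkContinuous (∏ i, ‖v i‖) (norm_algAppend k v)).completion

theorem append_tprod (k : ℕ) {m : ℕ} (w : Fin k → H) (v : Fin m → H) :
    append k v (tprod w) = tprod (Fin.append w v) :=
  (ContinuousLinearMap.completion_apply_coe _ _).trans
    (congrArg _ (algAppend_algTprod k w v))

/-- The symmetric (bosonic) subspace of the Hilbert tensor power. -/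
def symSubspace (H : Type*) [NormedAddCommGroup H] [InnerProductSpace ℂ H] (n : ℕ) :
    Submodule ℂ (TensorPow H n) where
  carrier := {x | ∀ σ : Equiv.Perm (Fin n), permute σ x = x}
  add_mem' hx hy σ := by rw [map_add, hx σ, hy σ]
  zero_mem' σ := map_zero _
  smul_mem' c x hx σ := by rw [map_smul, hx σ]

theorem isClosed_symSubspace (H : Type*) [NormedAddCommGroup H] [InnerProductSpace ℂ H] (n : ℕ) :
    IsClosed (symSubspace H n : Set (TensorPow H n)) := by
  have : (symSubspace H n : Set (TensorPow H n))
      = ⋂ σ : Equiv.Perm (Fin n), {x | permute σ x = x} := by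
    ext x; simp [symSubspace]
  rw [this]
  exact isClosed_iInter fun σ => isClosed_eq (permute σ).continuous continuous_id

/-- The bosonic `n`-particle Hilbert space `⨂_sym^n H`, with the inner product of the tensor
power. -/
def SymPow (H : Type*) [NormedAddCommGroup H] [InnerProductSpace ℂ H] (n : ℕ) : Type _ :=
  symSubspace H n

instance (n : ℕ) : NormedAddCommGroup (SymPow H n) :=
  inferInstanceAs (NormedAddCommGroup (symSubspace H n))

instance (n : ℕ) : InnerProductSpace ℂ (SymPow H n) :=
  inferInstanceAs (InnerProductSpace ℂ (symSubspace H n))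

instance (n : ℕ) : CompleteSpace (SymPow H n) :=
  (isClosed_symSubspace H n).completeSpace_coe

/-- The isometric inclusion of the bosonic `n`-particle space into the full tensor power. -/
def symIncl (H : Type*) [NormedAddCommGroup H] [InnerProductSpace ℂ H] (n : ℕ) :
    SymPow H n →L[ℂ] TensorPow H n :=
  (symSubspace H n).subtypeL

/-- The vector `u^{⊗ n} = u ⊗ ⋯ ⊗ u` of the bosonic `n`-particle space. -/
def powTensor (u : H) (n : ℕ) : SymPow H n :=
  (⟨tprod fun _ => u, fun σ => permute_tprod σ _⟩ : symSubspace H n)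

end Hilbert

/-! ### Trace class operators -/

section TraceClass

variable {E : Type*} [NormedAddCommGroup E] [InnerProductSpace ℂ E] [CompleteSpace E]

/-- The index set of `someBasis`. -/
def basisIndex (E : Type*) [NormedAddCommGroup E] [InnerProductSpace ℂ E] [CompleteSpace E] :
    Set E :=
  (exists_hilbertBasis ℂ E).choose

/-- Some orthonormal basis of the Hilbert space `E`. The notions below do not depend on this
choice. -/
def someBasis (E : Type*) [NormedAddCommGroup E] [InnerProductSpace ℂ E] [CompleteSpace E] :
    HilbertBasis (basisIndex E) ℂ E :=
  (exists_hilbertBasis ℂ E).choose_spec.choose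

/-- `T` is trace class: `Tr |T| < ∞`, where `|T| = (T* T)^{1/2}`. -/
def IsTraceClass (T : E →L[ℂ] E) : Prop :=
  Summable fun i => (⟪someBasis E i, CFC.abs T (someBasis E i)⟫_ℂ).re

/-- The trace of a (trace class) operator. -/
def trace (T : E →L[ℂ] E) : ℂ :=
  ∑' i, ⟪someBasis E i, T (someBasis E i)⟫_ℂ

/-- Weak-`*` convergence in the trace class, regarded as the dual of the space of compact
operators: `Tr (T_N K) → Tr (T K)` for every compact operator `K`. -/
def TendstoWeakStar {X : Type*} (T : X → E →L[ℂ] E) (l : Filter X) (S : E →L[ℂ] E) : Prop :=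
  ∀ K : E →L[ℂ] E, IsCompactOperator K →
    Tendsto (fun N => trace (T N ∘L K)) l (𝓝 (trace (S ∘L K)))

end TraceClass

/-! ### Bosonic states and reduced density matrices -/

section States

variable {H : Type*} [NormedAddCommGroup H] [InnerProductSpace ℂ H]

/-- A bosonic `N`-body state: a positive (in particular self-adjoint) trace class operator with
trace one on the bosonic `N`-particle space. -/
structure IsBosonicState {N : ℕ} (Γ : SymPow H N →L[ℂ] SymPow H N) : Prop where
  isPositive : Γ.IsPositive
  isTraceClass : IsTraceClass Γ
  trace_eq_one : trace Γ = 1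

/-- The partial trace of `T` over the last `m` of the `k + m` tensor factors: with an orthonormal
basis `(e_j)` of `H` and `V_α x = x ⊗ e_{α 1} ⊗ ⋯ ⊗ e_{α m}`, it is `∑_α V_α* T V_α`. -/
def partialTrace [CompleteSpace H] (k m : ℕ) (T : TensorPow H (k + m) →L[ℂ] TensorPow H (k + m)) :
    TensorPow H k →L[ℂ] TensorPow H k :=
  ∑' α : Fin m → basisIndex H,
    (append k fun j => someBasis H (α j)).adjoint ∘L T ∘L (append k fun j => someBasis H (α j))

/-- The `k`-body reduced density matrix of an operator `Γ` on the bosonic space of `k + m`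
particles: extend `Γ` by zero to the full tensor power, take the partial trace over `m` particles,
and regard the result as an operator on the bosonic `k`-particle space. -/
def reducedDensityMatrix [CompleteSpace H] (k m : ℕ)
    (Γ : SymPow H (k + m) →L[ℂ] SymPow H (k + m)) : SymPow H k →L[ℂ] SymPow H k :=
  (symIncl H k).adjoint ∘L
    partialTrace k m (symIncl H (k + m) ∘L Γ ∘L (symIncl H (k + m)).adjoint) ∘L
    symIncl H k

end States

end DeFinetti

end

/-!
Fix an ultrafilter on `ℕ` and view the states `Γ_N` as a single state on the C⋆-algebra of bounded
sequences of operators, by taking the limit of `Tr (Γ_N A_N)` along the ultrafilter. In its GNS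
representation the sequences tending to `0` in norm vanish, so by the canonical commutation
relations the normalized one-body operators `N⁻¹ a*(f) a(g)` become commuting operators `T f g` with
`T f g * T f' g' = T f g' * T f' g`. The expectation of `(T f g) ^ k` is the limit of
`⟨g^{⊗ k}, γ_N^{(k)} f^{⊗ k}⟩`. A character of the commutative C⋆-algebra which they generate sends
`T f g` to a positive form of rank at most one, that is to `⟨g, u⟩⟨u, f⟩` with `‖u‖ ≤ 1`, so the
Riesz representation theorem turns the state into a measure on the unit ball. Averaging over the
phase of `u` makes this measure invariant.

Uniqueness: the monomials in the functions `⟨g, u⟩` and `⟨u, h⟩` span a star algebra separating the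
points of the ball. A monomial with different numbers of factors of the two kinds has integral `0`
by phase invariance, and one with `k` factors of each kind integrates to a matrix element of
`γ^{(k)}`.
-/

namespace DeFinetti

/-! ### Totality of pure tensors and of tensor powers -/

section Totality

variable {H : Type*} [NormedAddCommGroup H] [InnerProductSpace ℂ H] {n : ℕ}

theorem clm_ext_tprod {E : Type*} [NormedAddCommGroup E] [NormedSpace ℂ E]
    {A B : TensorPow H n →L[ℂ] E} (h : ∀ v, A (tprod v) = B (tprod v)) : A = B := by
  let ι : AlgTensorPower H n →L[ℂ] TensorPow H n := UniformSpace.Completion.toComplL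
  have hι : A.toLinearMap ∘ₗ ι.toLinearMap = B.toLinearMap ∘ₗ ι.toLinearMap := algTensor_ext h
  ext x
  exact UniformSpace.Completion.induction_on (α := AlgTensorPower H n) x
    (isClosed_eq A.continuous B.continuous) fun a => DFunLike.congr_fun hι a

theorem ext_inner_tprod {x y : TensorPow H n}
    (h : ∀ v, ⟪x, tprod v⟫_ℂ = ⟪y, tprod v⟫_ℂ) : x = y :=
  ext_inner_right ℂ <| DFunLike.congr_fun (clm_ext_tprod (A := innerSL ℂ x) (B := innerSL ℂ y) h)

theorem norm_tprod (v : Fin n → H) : ‖tprod v‖ = ∏ i, ‖v i‖ := by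
  have h : ((‖tprod v‖ ^ 2 : ℝ) : ℂ) = (((∏ i, ‖v i‖) ^ 2 : ℝ) : ℂ) := by
    have := inner_tprod v v
    simp only [inner_self_eq_norm_sq_to_K, Finset.prod_pow] at this
    exact_mod_cast this
  exact (pow_left_inj₀ (norm_nonneg _) (Finset.prod_nonneg fun i _ => norm_nonneg _)
    two_ne_zero).mp (Complex.ofReal_injective h)

/-- The pure tensor `tprod v` as a continuous multilinear function of `v`. -/
noncomputable def tprodMultilinear (H : Type*) [NormedAddCommGroup H] [InnerProductSpace ℂ H]
    (n : ℕ) : H [×n]→L[ℂ] TensorPow H n :=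
  MultilinearMap.mkContinuous
    { toFun := tprod
      map_update_add' := fun {inst} v i a b => by
        obtain rfl : inst = instDecidableEqFin n := Subsingleton.elim _ _
        refine ext_inner_tprod fun w => ?_
        rw [inner_add_left, inner_tprod, inner_tprod, inner_tprod, prod_update_add]
      map_update_smul' := fun {inst} v i c a => by
        obtain rfl : inst = instDecidableEqFin n := Subsingleton.elim _ _
        refine ext_inner_tprod fun w => ?_
        rw [inner_smul_left, inner_tprod, inner_tprod, prod_update_smul] }
    1 fun v => by rw [one_mul]; exact (norm_tprod v).le

theorem eq_zero_of_diagonal_eq_zero {𝕜 E F : Type*} [NontriviallyNormedField 𝕜] [CharZero 𝕜]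
    [NormedAddCommGroup E] [NormedSpace 𝕜 E] [NormedAddCommGroup F] [NormedSpace 𝕜 F]
    (φ : E [×n]→L[𝕜] F) (hsymm : ∀ (σ : Equiv.Perm (Fin n)) v, φ (fun i => v (σ i)) = φ v)
    (hdiag : ∀ u, φ (fun _ => u) = 0) (v : Fin n → E) : φ v = 0 := by
  have hsum := φ.iteratedFDeriv_comp_diagonal 0 v
  simp only [hdiag, hsymm, Finset.sum_const, iteratedFDeriv_fun_zero, Pi.zero_apply,
    _root_.zero_apply, ← Nat.cast_smul_eq_nsmul 𝕜] at hsum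
  exact (smul_eq_zero.mp hsum.symm).resolve_left (by simp [Fintype.card_ne_zero])

theorem symIncl_powTensor (u : H) : symIncl H n (powTensor u n) = tprod fun _ => u := rfl

theorem inner_symIncl (x y : SymPow H n) :
    ⟪symIncl H n x, symIncl H n y⟫_ℂ = ⟪x, y⟫_ℂ := rfl

theorem norm_symIncl_apply (x : SymPow H n) : ‖symIncl H n x‖ = ‖x‖ := rfl

theorem norm_symIncl_le : ‖symIncl H n‖ ≤ 1 :=
  ContinuousLinearMap.opNorm_le_bound _ zero_le_one fun x => by
    rw [one_mul, norm_symIncl_apply]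

theorem inner_permute (σ : Equiv.Perm (Fin n)) (x y : TensorPow H n) :
    ⟪permute σ x, permute σ y⟫_ℂ = ⟪x, y⟫_ℂ := by
  have h : (permute σ).adjoint ∘L permute σ = ContinuousLinearMap.id ℂ (TensorPow H n) := by
    refine clm_ext_tprod fun v => ext_inner_tprod fun w => ?_
    rw [ContinuousLinearMap.comp_apply, ContinuousLinearMap.adjoint_inner_left, permute_tprod,
      permute_tprod, inner_tprod, ContinuousLinearMap.id_apply, inner_tprod]
    exact Equiv.prod_comp σ.symm fun i => ⟪v i, w i⟫_ℂ
  rw [← ContinuousLinearMap.adjoint_inner_left, ← ContinuousLinearMap.comp_apply, h,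
    ContinuousLinearMap.id_apply]

theorem inner_symIncl_tprod_perm (x : SymPow H n) (σ : Equiv.Perm (Fin n)) (v : Fin n → H) :
    ⟪symIncl H n x, tprod fun i => v (σ i)⟫_ℂ = ⟪symIncl H n x, tprod v⟫_ℂ := by
  have hx : permute σ⁻¹ (symIncl H n x) = symIncl H n x := x.2 σ⁻¹
  rw [← inner_permute σ⁻¹ _ (tprod v), permute_tprod, hx]
  rfl

theorem ext_inner_powTensor {x y : SymPow H n}
    (h : ∀ u, ⟪powTensor u n, x⟫_ℂ = ⟪powTensor u n, y⟫_ℂ) : x = y := by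
  have hzero : symIncl H n (x - y) = 0 := ext_inner_tprod fun v => by
    rw [inner_zero_left]
    refine eq_zero_of_diagonal_eq_zero
      ((innerSL ℂ (symIncl H n (x - y))).compContinuousMultilinearMap (tprodMultilinear H n))
      (fun σ v => inner_symIncl_tprod_perm _ σ v) (fun u => ?_) v
    change ⟪x - y, powTensor u n⟫_ℂ = 0
    rw [← inner_conj_symm, inner_sub_right, h, sub_self, map_zero]
  rw [← sub_eq_zero, ← norm_eq_zero, ← norm_symIncl_apply, hzero, norm_zero]

theorem clm_ext_powTensor {E : Type*} [NormedAddCommGroup E] [InnerProductSpace ℂ E]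
    [CompleteSpace E] {A B : SymPow H n →L[ℂ] E}
    (h : ∀ u, A (powTensor u n) = B (powTensor u n)) : A = B :=
  ContinuousLinearMap.adjoint.injective <|
    ContinuousLinearMap.ext fun x => ext_inner_powTensor fun u => by
      rw [ContinuousLinearMap.adjoint_inner_right, ContinuousLinearMap.adjoint_inner_right, h]

theorem clm_ext_inner_powTensor {m : ℕ} {A B : SymPow H n →L[ℂ] SymPow H m}
    (h : ∀ f g : H, ⟪powTensor g m, A (powTensor f n)⟫_ℂ = ⟪powTensor g m, B (powTensor f n)⟫_ℂ) :
    A = B :=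
  clm_ext_powTensor fun f => ext_inner_powTensor fun g => h f g

theorem inner_powTensor (u v : H) : ⟪powTensor u n, powTensor v n⟫_ℂ = ⟪u, v⟫_ℂ ^ n := by
  rw [← inner_symIncl, symIncl_powTensor, symIncl_powTensor, inner_tprod, Finset.prod_const,
    Finset.card_univ, Fintype.card_fin]

theorem norm_powTensor (u : H) : ‖powTensor u n‖ = ‖u‖ ^ n := by
  rw [← norm_symIncl_apply, symIncl_powTensor, norm_tprod, Finset.prod_const, Finset.card_univ,
    Fintype.card_fin]

theorem differentiable_powTensor : Differentiable ℂ fun u : H => powTensor u n := by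
  have h : (fun u : H => powTensor u n) = fun u =>
      (symIncl H n).adjoint (tprodMultilinear H n fun _ => u) := by
    funext u
    refine ext_inner_right ℂ fun x => ?_
    rw [ContinuousLinearMap.adjoint_inner_left]
    rfl
  rw [h]
  have hdiff : Differentiable ℂ (tprodMultilinear H n) := fun v =>
    (tprodMultilinear H n).hasFDerivAt v |>.differentiableAt
  exact (symIncl H n).adjoint.differentiable.comp <|
    hdiff.comp (differentiable_pi.mpr fun _ => differentiable_id)

end Totality

/-! ### Creation and annihilation operators -/

section Fock

variable {H : Type*} [NormedAddCommGroup H] [InnerProductSpace ℂ H] {k m n : ℕ}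

theorem adjoint_append_tprod (v : Fin m → H) (w : Fin (k + m) → H) :
    (append k v).adjoint (tprod w)
      = (∏ i, ⟪v i, w (Fin.natAdd k i)⟫_ℂ) • tprod fun i => w (Fin.castAdd m i) :=
  ext_inner_tprod fun x => by
    simp only [ContinuousLinearMap.adjoint_inner_left, append_tprod, inner_tprod,
      Fin.prod_univ_add, Fin.append_left, Fin.append_right, inner_smul_left, map_prod,
      inner_conj_symm, mul_comm]

theorem adjoint_append_comp_append (v w : Fin m → H) :
    (append k v).adjoint ∘L append k w
      = (∏ i, ⟪v i, w i⟫_ℂ) • ContinuousLinearMap.id ℂ (TensorPow H k) :=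
  clm_ext_tprod fun x => by
    simp only [ContinuousLinearMap.comp_apply, append_tprod, adjoint_append_tprod,
      Fin.append_left, Fin.append_right, smul_apply, ContinuousLinearMap.id_apply]

theorem norm_append_le (v : Fin m → H) : ‖append k v‖ ≤ ∏ i, ‖v i‖ := by
  refine le_of_sq_le_sq ?_ (Finset.prod_nonneg fun i _ => norm_nonneg _)
  rw [sq, ← ContinuousLinearMap.norm_adjoint_comp_self, adjoint_append_comp_append, norm_smul]
  simp only [inner_self_eq_norm_sq_to_K, Finset.prod_pow, norm_pow, norm_prod, RCLike.norm_ofReal,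
    abs_norm]
  exact mul_le_of_le_one_right (by positivity) ContinuousLinearMap.norm_id_le

/-- The symmetrized tensor product with `f^{⊗ k}`, that is `x ↦ P (x ⊗ f ⊗ ⋯ ⊗ f)` with `P` the
orthogonal projection onto the bosonic space. The number of factors of the result is a variable
`n` with `m + k = n`, so that it can be `k + m`. -/
noncomputable def symAppend (f : H) (h : m + k = n) : TensorPow H m →L[ℂ] SymPow H n :=
  h ▸ (symIncl H (m + k)).adjoint ∘L append m fun _ : Fin k => f

theorem norm_symAppend_le (f : H) (h : m + k = n) : ‖symAppend f h‖ ≤ ‖f‖ ^ k := by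
  subst h
  refine (ContinuousLinearMap.opNorm_comp_le _ _).trans ?_
  have happend := norm_append_le (k := m) fun _ : Fin k => f
  rw [Finset.prod_const, Finset.card_univ, Fintype.card_fin] at happend
  rw [LinearIsometryEquiv.norm_map]
  exact (mul_le_of_le_one_left (norm_nonneg _) norm_symIncl_le).trans happend

theorem adjoint_symAppend_powTensor (f u : H) (h : m + k = n) :
    (symAppend f h).adjoint (powTensor u n) = ⟪f, u⟫_ℂ ^ k • tprod fun _ => u := by
  subst h
  change ((symIncl H (m + k)).adjoint ∘L append m fun _ : Fin k => f).adjoint _ = _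
  rw [ContinuousLinearMap.adjoint_comp, ContinuousLinearMap.adjoint_adjoint,
    ContinuousLinearMap.comp_apply, symIncl_powTensor, adjoint_append_tprod, Finset.prod_const,
    Finset.card_univ, Fintype.card_fin]

/-- The creation operator `a*(f)` on the `N`-particle space, divided by `√(N + 1)`. -/
noncomputable def create (N : ℕ) (f : H) : SymPow H N →L[ℂ] SymPow H (N + 1) :=
  symAppend f rfl ∘L symIncl H N

theorem norm_create_le (N : ℕ) (f : H) : ‖create N f‖ ≤ ‖f‖ :=
  (ContinuousLinearMap.opNorm_comp_le _ _).trans <|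
    (mul_le_of_le_one_right (norm_nonneg _) norm_symIncl_le).trans <|
      (norm_symAppend_le f rfl).trans_eq (pow_one _)

theorem adjoint_create_powTensor (N : ℕ) (g u : H) :
    (create N g).adjoint (powTensor u (N + 1)) = ⟪g, u⟫_ℂ • powTensor u N :=
  ext_inner_right ℂ fun x => by
    rw [create, ContinuousLinearMap.adjoint_comp, ContinuousLinearMap.comp_apply,
      ContinuousLinearMap.adjoint_inner_left, adjoint_symAppend_powTensor, pow_one,
      ← symIncl_powTensor, inner_smul_left, inner_smul_left, inner_symIncl]

theorem inner_powTensor_create {N : ℕ} (f u : H) (x : SymPow H N) :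
    ⟪powTensor u (N + 1), create N f x⟫_ℂ = ⟪u, f⟫_ℂ * ⟪powTensor u N, x⟫_ℂ := by
  rw [← ContinuousLinearMap.adjoint_inner_left, adjoint_create_powTensor, inner_smul_left,
    inner_conj_symm]

theorem create_add (N : ℕ) (f g : H) : create N (f + g) = create N f + create N g :=
  clm_ext_inner_powTensor fun u v => by
    simp only [inner_powTensor_create, add_apply, inner_add_right, add_mul]

theorem create_smul (N : ℕ) (c : ℂ) (f : H) : create N (c • f) = c • create N f :=
  clm_ext_inner_powTensor fun u v => by
    simp only [inner_powTensor_create, smul_apply, inner_smul_right, mul_assoc]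

theorem create_comp_create_comm (N : ℕ) (f g : H) :
    create (N + 1) f ∘L create N g = create (N + 1) g ∘L create N f :=
  clm_ext_inner_powTensor fun u v => by
    simp only [ContinuousLinearMap.comp_apply, inner_powTensor_create, mul_left_comm]

/-- The operator `N⁻¹ a*(f) a(g)` on the `N`-particle space. -/
noncomputable def oneBody (f g : H) : ∀ N : ℕ, SymPow H N →L[ℂ] SymPow H N
  | 0 => 0
  | N + 1 => create N f ∘L (create N g).adjoint

theorem oneBody_add (f f' g : H) (N : ℕ) :
    oneBody (f + f') g N = oneBody f g N + oneBody f' g N := by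
  cases N with
  | zero => exact (add_zero _).symm
  | succ N => simp only [oneBody, create_add, ContinuousLinearMap.add_comp]

theorem oneBody_smul (c : ℂ) (f g : H) (N : ℕ) : oneBody (c • f) g N = c • oneBody f g N := by
  cases N with
  | zero => exact (smul_zero _).symm
  | succ N => simp only [oneBody, create_smul, ContinuousLinearMap.smul_comp]

theorem adjoint_oneBody (f g : H) (N : ℕ) : (oneBody f g N).adjoint = oneBody g f N := by
  cases N with
  | zero => exact map_zero _
  | succ N => simp only [oneBody, ContinuousLinearMap.adjoint_comp,
      ContinuousLinearMap.adjoint_adjoint]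

theorem norm_create_comp_comp_adjoint_le (N : ℕ) (f g : H) (A : SymPow H N →L[ℂ] SymPow H N) :
    ‖create N f ∘L A ∘L (create N g).adjoint‖ ≤ ‖f‖ * ‖g‖ * ‖A‖ :=
  calc ‖create N f ∘L A ∘L (create N g).adjoint‖
      ≤ ‖create N f‖ * (‖A‖ * ‖(create N g).adjoint‖) :=
        (ContinuousLinearMap.opNorm_comp_le _ _).trans <|
          mul_le_mul_of_nonneg_left (ContinuousLinearMap.opNorm_comp_le _ _) (norm_nonneg _)
    _ ≤ ‖f‖ * (‖A‖ * ‖g‖) := by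
        rw [LinearIsometryEquiv.norm_map]
        gcongr <;> exact norm_create_le N _
    _ = ‖f‖ * ‖g‖ * ‖A‖ := by ring

theorem norm_oneBody_le (f g : H) (N : ℕ) : ‖oneBody f g N‖ ≤ ‖f‖ * ‖g‖ := by
  cases N with
  | zero => simpa only [oneBody, norm_zero] using by positivity
  | succ N =>
    refine (norm_create_comp_comp_adjoint_le N f g (ContinuousLinearMap.id ℂ _)).trans ?_
    exact mul_le_of_le_one_right (by positivity) ContinuousLinearMap.norm_id_le

theorem hasDerivAt_inner_add_smul (w u f : H) :
    HasDerivAt (fun t : ℂ => ⟪w, u + t • f⟫_ℂ) ⟪w, f⟫_ℂ 0 := by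
  simp only [inner_add_right, inner_smul_right]
  exact (((hasDerivAt_id 0).mul_const ⟪w, f⟫_ℂ).const_add ⟪w, u⟫_ℂ).congr_deriv (one_mul _)

theorem hasDerivAt_powTensor_add_smul (N : ℕ) (u f : H) :
    HasDerivAt (fun t : ℂ => powTensor (u + t • f) (N + 1))
      (((N : ℂ) + 1) • create N f (powTensor u N)) 0 := by
  have hdiff : DifferentiableAt ℂ (fun t : ℂ => powTensor (u + t • f) (N + 1)) 0 :=
    differentiable_powTensor.comp
      ((differentiable_const u).add (differentiable_id.smul_const f)) |>.differentiableAt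
  convert hdiff.hasDerivAt using 1
  refine ext_inner_powTensor fun w => ?_
  have hinner := (innerSL ℂ (powTensor w (N + 1))).hasFDerivAt.comp_hasDerivAt 0 hdiff.hasDerivAt
  have hpow := (hasDerivAt_inner_add_smul w u f).pow (N + 1)
  simp only [Function.comp_def, innerSL_apply_apply, inner_powTensor] at hinner
  rw [hinner.unique hpow, inner_smul_right, inner_powTensor_create, inner_powTensor, zero_smul,
    add_zero, Nat.cast_succ, Nat.add_sub_cancel]
  ring

theorem hasDerivAt_inner_smul_powTensor (N : ℕ) (g u f : H) :
    HasDerivAt (fun t : ℂ => ⟪g, u + t • f⟫_ℂ • powTensor (u + t • f) N)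
      (⟪g, f⟫_ℂ • powTensor u N + (N : ℂ) • oneBody f g N (powTensor u N)) 0 := by
  have hinner := hasDerivAt_inner_add_smul g u f
  cases N with
  | zero =>
    have hconst (v : H) : powTensor v 0 = powTensor u 0 := ext_inner_powTensor fun w => by
      simp only [inner_powTensor, pow_zero]
    simpa only [hconst, Nat.cast_zero, zero_smul, add_zero] using hinner.smul_const (powTensor u 0)
  | succ N =>
    refine (hinner.smul (hasDerivAt_powTensor_add_smul N u f)).congr_deriv ?_
    simp only [oneBody, ContinuousLinearMap.comp_apply, adjoint_create_powTensor, map_smul,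
      zero_smul, add_zero, Nat.cast_succ]
    rw [smul_comm]
    exact add_comm _ _

/-- This canonical commutation relation is the derivative at `t = 0` of
`a(g) (u + t • f)^{⊗ (N + 1)} = ⟨g, u + t • f⟩ (u + t • f)^{⊗ N}`. -/
theorem adjoint_create_comp_create (N : ℕ) (f g : H) :
    ((N : ℂ) + 1) • ((create N g).adjoint ∘L create N f)
      = ⟪g, f⟫_ℂ • ContinuousLinearMap.id ℂ (SymPow H N) + (N : ℂ) • oneBody f g N := by
  refine clm_ext_powTensor fun u => ?_
  have hleft := (create N g).adjoint.hasFDerivAt.comp_hasDerivAt 0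
    (hasDerivAt_powTensor_add_smul N u f)
  have hright := hasDerivAt_inner_smul_powTensor N g u f
  simp only [Function.comp_def, adjoint_create_powTensor, map_smul] at hleft
  exact hleft.unique hright

end Fock

/-! ### One-body operators for large particle number -/

section Asymptotics

theorem norm_pow_succ_sub_pow_succ_le {A : Type*} [NormedRing A] {x y : A} {R : ℝ} (hx : ‖x‖ ≤ R)
    (hy : ‖y‖ ≤ R) (k : ℕ) : ‖x ^ (k + 1) - y ^ (k + 1)‖ ≤ (k + 1) * R ^ k * ‖x - y‖ := by
  induction k with
  | zero => simp
  | succ k ih =>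
    have hxk : ‖x ^ (k + 1)‖ ≤ R ^ (k + 1) :=
      (norm_pow_le' x k.succ_pos).trans (pow_le_pow_left₀ (norm_nonneg x) hx _)
    calc ‖x ^ (k + 2) - y ^ (k + 2)‖
        = ‖x ^ (k + 1) * (x - y) + (x ^ (k + 1) - y ^ (k + 1)) * y‖ := by
          congr 1; noncomm_ring
      _ ≤ ‖x ^ (k + 1)‖ * ‖x - y‖ + ‖x ^ (k + 1) - y ^ (k + 1)‖ * ‖y‖ :=
          (norm_add_le _ _).trans (add_le_add (norm_mul_le _ _) (norm_mul_le _ _))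
      _ ≤ R ^ (k + 1) * ‖x - y‖ + (k + 1) * R ^ k * ‖x - y‖ * R := by
          have := (norm_nonneg y).trans hy
          gcongr
      _ = ((k + 1 : ℕ) + 1) * R ^ (k + 1) * ‖x - y‖ := by push_cast; ring

theorem tendsto_norm_pow_sub_pow {ι : Type*} {l : Filter ι} {A : ι → Type*}
    [∀ i, NormedRing (A i)] {x y : ∀ i, A i} {R : ℝ} (hx : ∀ i, ‖x i‖ ≤ R)
    (hy : ∀ i, ‖y i‖ ≤ R) (hxy : Tendsto (fun i => ‖x i - y i‖) l (𝓝 0)) (k : ℕ) :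
    Tendsto (fun i => ‖x i ^ k - y i ^ k‖) l (𝓝 0) := by
  cases k with
  | zero => simp only [pow_zero, sub_self, norm_zero, tendsto_const_nhds]
  | succ k =>
    refine squeeze_zero (fun i => norm_nonneg _)
      (fun i => norm_pow_succ_sub_pow_succ_le (hx i) (hy i) k) ?_
    simpa only [mul_zero] using hxy.const_mul ((k + 1) * R ^ k)

variable {H : Type*} [NormedAddCommGroup H] [InnerProductSpace ℂ H]

theorem tendsto_norm_adjoint_create_comp_create_sub_oneBody (f g : H) :
    Tendsto (fun N => ‖(create N g).adjoint ∘L create N f - oneBody f g N‖) atTop (𝓝 0) := by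
  have hbound (N : ℕ) : ‖(create N g).adjoint ∘L create N f - oneBody f g N‖
      ≤ 2 * (‖f‖ * ‖g‖) / ((N : ℝ) + 1) := by
    have hccr : ((N : ℂ) + 1) • ((create N g).adjoint ∘L create N f - oneBody f g N)
        = ⟪g, f⟫_ℂ • ContinuousLinearMap.id ℂ (SymPow H N) - oneBody f g N := by
      rw [smul_sub, adjoint_create_comp_create, add_smul, one_smul]
      abel
    have hnorm : ‖(N : ℂ) + 1‖ = (N : ℝ) + 1 := by
      rw [← Nat.cast_succ, Complex.norm_natCast, Nat.cast_succ]
    rw [le_div_iff₀' (by positivity), ← hnorm, ← norm_smul, hccr, two_mul]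
    refine (norm_sub_le _ _).trans (add_le_add ?_ (norm_oneBody_le f g N))
    rw [norm_smul, mul_comm ‖f‖]
    exact (mul_le_of_le_one_right (norm_nonneg _) ContinuousLinearMap.norm_id_le).trans
      (norm_inner_le_norm g f)
  refine squeeze_zero (fun N => norm_nonneg _) hbound ?_
  exact tendsto_const_nhds.div_atTop (tendsto_natCast_atTop_atTop.atTop_add tendsto_const_nhds)

theorem tendsto_norm_oneBody_mul_sub (f g f' g' : H) :
    Tendsto (fun N => ‖oneBody f g (N + 1) * oneBody f' g' (N + 1)
      - create N f ∘L oneBody f' g N ∘L (create N g').adjoint‖) atTop (𝓝 0) := by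
  refine squeeze_zero (fun N => norm_nonneg _) (fun N => ?_) <| by
    simpa only [mul_zero] using
      (tendsto_norm_adjoint_create_comp_create_sub_oneBody f' g).const_mul (‖f‖ * ‖g'‖)
  refine le_of_eq_of_le (congrArg norm ?_) (norm_create_comp_comp_adjoint_le N f g' _)
  rw [ContinuousLinearMap.sub_comp, ContinuousLinearMap.comp_sub]
  rfl

theorem create_comp_oneBody_comp_adjoint_create (N : ℕ) (f g f' g' : H) :
    create N f ∘L oneBody f' g N ∘L (create N g').adjoint
      = create N f ∘L oneBody f' g' N ∘L (create N g).adjoint := by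
  cases N with
  | zero => simp only [oneBody, ContinuousLinearMap.zero_comp]
  | succ N =>
    have hcomm := congrArg ContinuousLinearMap.adjoint (create_comp_create_comm N g g')
    simp only [ContinuousLinearMap.adjoint_comp] at hcomm
    simp only [oneBody, ContinuousLinearMap.comp_assoc, hcomm]

theorem tendsto_norm_oneBody_exchange (f g f' g' : H) :
    Tendsto (fun N => ‖oneBody f g N * oneBody f' g' N - oneBody f g' N * oneBody f' g N‖) atTop
      (𝓝 0) := by
  rw [← tendsto_add_atTop_iff_nat 1]
  have hleft := tendsto_norm_oneBody_mul_sub f g f' g'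
  have hright := tendsto_norm_oneBody_mul_sub f g' f' g
  simp only [create_comp_oneBody_comp_adjoint_create _ f g' f' g] at hright
  refine squeeze_zero (fun N => norm_nonneg _) (fun N => ?_) <| by
    simpa only [add_zero] using hleft.add hright
  rw [norm_sub_rev (oneBody f g' (N + 1) * _)]
  exact norm_sub_le_norm_sub_add_norm_sub _ _ _

/-- The normally ordered counterpart `a*(f)^k a(g)^k` of the power `(a*(f) a(g))^k`, divided by
`N (N - 1) ⋯ (N - k + 1)`. It vanishes on fewer than `k` particles. -/
noncomputable def kBody (f g : H) : ℕ → ∀ N : ℕ, SymPow H N →L[ℂ] SymPow H N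
  | 0, _ => ContinuousLinearMap.id ℂ _
  | _ + 1, 0 => 0
  | k + 1, N + 1 => create N f ∘L kBody f g k N ∘L (create N g).adjoint

theorem inner_powTensor_kBody (f g u v : H) (k m : ℕ) :
    ⟪powTensor u (m + k), kBody f g k (m + k) (powTensor v (m + k))⟫_ℂ
      = (⟪u, f⟫_ℂ * ⟪g, v⟫_ℂ) ^ k * ⟪u, v⟫_ℂ ^ m := by
  induction k with
  | zero => rw [add_zero, kBody, ContinuousLinearMap.id_apply, inner_powTensor, pow_zero, one_mul]
  | succ k ih =>
    change ⟪powTensor u (m + k + 1), create (m + k) f (kBody f g k (m + k)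
      ((create (m + k) g).adjoint (powTensor v (m + k + 1))))⟫_ℂ = _
    rw [inner_powTensor_create, adjoint_create_powTensor, map_smul, inner_smul_right, ih]
    ring

theorem oneBody_pow_succ (f g : H) (N k : ℕ) :
    oneBody f g (N + 1) ^ (k + 1)
      = create N f ∘L (((create N g).adjoint ∘L create N f) ^ k) ∘L (create N g).adjoint := by
  induction k with
  | zero => rw [zero_add, pow_one]; rfl
  | succ k ih => rw [pow_succ, ih, pow_succ]; rfl

theorem tendsto_norm_oneBody_pow_sub_kBody (f g : H) (k : ℕ) :
    Tendsto (fun N => ‖oneBody f g N ^ k - kBody f g k N‖) atTop (𝓝 0) := by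
  induction k with
  | zero => exact tendsto_const_nhds.congr fun N => (norm_eq_zero.mpr (sub_self _)).symm
  | succ k ih =>
    rw [← tendsto_add_atTop_iff_nat 1]
    have hccr := tendsto_norm_pow_sub_pow (k := k)
      (fun N => (ContinuousLinearMap.opNorm_comp_le _ _).trans (mul_le_mul
        ((LinearIsometryEquiv.norm_map _ _).trans_le (norm_create_le N g)) (norm_create_le N f)
        (norm_nonneg _) (norm_nonneg _)))
      (fun N => (norm_oneBody_le f g N).trans_eq (mul_comm _ _))
      (tendsto_norm_adjoint_create_comp_create_sub_oneBody f g)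
    refine squeeze_zero (fun N => norm_nonneg _) (fun N => ?_) <| by
      simpa only [add_zero, mul_zero] using (hccr.add ih).const_mul (‖f‖ * ‖g‖)
    rw [oneBody_pow_succ, kBody, ← ContinuousLinearMap.comp_sub, ← ContinuousLinearMap.sub_comp]
    refine (norm_create_comp_comp_adjoint_le N f g _).trans ?_
    gcongr
    exact norm_sub_le_norm_sub_add_norm_sub _ _ _

theorem norm_smul_one_sub_oneBody_le (f : H) (N : ℕ) :
    ‖((‖f‖ ^ 2 : ℝ) : ℂ) • (1 : SymPow H N →L[ℂ] SymPow H N) - oneBody f f N‖ ≤ ‖f‖ ^ 2 := by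
  have hnonneg : 0 ≤ oneBody f f N := by
    rw [ContinuousLinearMap.nonneg_iff_isPositive]
    cases N with
    | zero => exact ContinuousLinearMap.isPositive_zero
    | succ N => exact ContinuousLinearMap.isPositive_self_comp_adjoint _
  have hle : oneBody f f N ≤ algebraMap ℝ _ (‖f‖ ^ 2) := by
    rw [← CStarAlgebra.norm_le_iff_le_algebraMap _ (by positivity) hnonneg, sq]
    exact norm_oneBody_le f f N
  have halg : ((‖f‖ ^ 2 : ℝ) : ℂ) • (1 : SymPow H N →L[ℂ] SymPow H N)
      = algebraMap ℝ (SymPow H N →L[ℂ] SymPow H N) (‖f‖ ^ 2) := by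
    rw [Algebra.algebraMap_eq_smul_one]
    rfl
  rw [halg, CStarAlgebra.norm_le_iff_le_algebraMap _ (by positivity) (sub_nonneg.mpr hle)]
  exact sub_le_self _ hnonneg

end Asymptotics

/-! ### Hilbert–Schmidt sums -/

section HilbertSchmidt

variable {E F : Type*} [NormedAddCommGroup E] [InnerProductSpace ℂ E]
  [NormedAddCommGroup F] [InnerProductSpace ℂ F] {ι κ : Type*}

theorem hasSum_norm_inner_sq (b : HilbertBasis ι ℂ E) (x : E) :
    HasSum (fun i => ‖⟪b i, x⟫_ℂ‖ ^ 2) (‖x‖ ^ 2) := by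
  have h := Complex.hasSum_re (b.hasSum_inner_mul_inner x x)
  have hterm (i : ι) : (⟪x, b i⟫_ℂ * ⟪b i, x⟫_ℂ).re = ‖⟪b i, x⟫_ℂ‖ ^ 2 := by
    rw [← inner_conj_symm, Complex.conj_mul', ← Complex.ofReal_pow, Complex.ofReal_re]
  have hsum : (⟪x, x⟫_ℂ).re = ‖x‖ ^ 2 := inner_self_eq_norm_sq (𝕜 := ℂ) x
  simpa only [hterm, hsum] using h

theorem summable_norm_inner_sq (t : HilbertBasis ι ℂ F) {x : κ → F}
    (hx : Summable fun i => ‖x i‖ ^ 2) :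
    Summable fun p : κ × ι => ‖⟪t p.2, x p.1⟫_ℂ‖ ^ 2 := by
  refine (summable_prod_of_nonneg fun p => sq_nonneg _).mpr
    ⟨fun i => (hasSum_norm_inner_sq t (x i)).summable, ?_⟩
  simpa only [(hasSum_norm_inner_sq t _).tsum_eq] using hx

variable [CompleteSpace E] [CompleteSpace F]

theorem norm_sq_le_tsum_adjoint (e : HilbertBasis κ ℂ E) (A : F →L[ℂ] E)
    (hA : Summable fun i => ‖A.adjoint (e i)‖ ^ 2) : ‖A‖ ^ 2 ≤ ∑' i, ‖A.adjoint (e i)‖ ^ 2 := by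
  have h0 : 0 ≤ ∑' i, ‖A.adjoint (e i)‖ ^ 2 := tsum_nonneg fun i => sq_nonneg _
  rw [← Real.sqrt_le_sqrt_iff h0, Real.sqrt_sq (norm_nonneg _)]
  refine ContinuousLinearMap.opNorm_le_bound _ (Real.sqrt_nonneg _) fun x => ?_
  rw [← Real.sqrt_sq (norm_nonneg x), ← Real.sqrt_mul h0]
  refine Real.le_sqrt_of_sq_le ?_
  have hparseval := hasSum_norm_inner_sq e (A x)
  rw [← hparseval.tsum_eq, ← tsum_mul_right]
  refine hparseval.summable.tsum_le_tsum (fun i => ?_) (hA.mul_right _)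
  rw [← ContinuousLinearMap.adjoint_inner_left, ← mul_pow]
  exact pow_le_pow_left₀ (norm_nonneg _) (norm_inner_le_norm _ _) 2

theorem tsum_inner_eq_tsum_inner_adjoint (t : HilbertBasis ι ℂ F) (e : HilbertBasis κ ℂ E)
    (A B : F →L[ℂ] E) (hA : Summable fun i => ‖A.adjoint (e i)‖ ^ 2)
    (hB : Summable fun i => ‖B.adjoint (e i)‖ ^ 2) :
    ∑' a, ⟪A (t a), B (t a)⟫_ℂ = ∑' i, ⟪B.adjoint (e i), A.adjoint (e i)⟫_ℂ := by
  have hsummable : Summable (Function.uncurry fun (i : κ) (a : ι) =>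
      ⟪B.adjoint (e i), t a⟫_ℂ * ⟪t a, A.adjoint (e i)⟫_ℂ) := by
    refine Summable.of_norm_bounded
      ((summable_norm_inner_sq t hA).add (summable_norm_inner_sq t hB)) fun p => ?_
    rw [Function.uncurry, norm_mul, norm_inner_symm]
    nlinarith [two_mul_le_add_sq ‖⟪t p.2, A.adjoint (e p.1)⟫_ℂ‖ ‖⟪t p.2, B.adjoint (e p.1)⟫_ℂ‖,
      norm_nonneg ⟪t p.2, A.adjoint (e p.1)⟫_ℂ, norm_nonneg ⟪t p.2, B.adjoint (e p.1)⟫_ℂ]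
  calc ∑' a, ⟪A (t a), B (t a)⟫_ℂ
      = ∑' a, ∑' i, ⟪B.adjoint (e i), t a⟫_ℂ * ⟪t a, A.adjoint (e i)⟫_ℂ := by
        refine tsum_congr fun a => (e.tsum_inner_mul_inner _ _).symm.trans (tsum_congr fun i => ?_)
        rw [ContinuousLinearMap.adjoint_inner_left, ContinuousLinearMap.adjoint_inner_right,
          mul_comm]
    _ = ∑' i, ∑' a, ⟪B.adjoint (e i), t a⟫_ℂ * ⟪t a, A.adjoint (e i)⟫_ℂ := hsummable.tsum_comm
    _ = ∑' i, ⟪B.adjoint (e i), A.adjoint (e i)⟫_ℂ :=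
        tsum_congr fun i => t.tsum_inner_mul_inner _ _

end HilbertSchmidt

/-! ### Product bases of the tensor powers -/

section ProductBasis

theorem eq_zero_of_dense_span {𝕜 ι E F : Type*} [Finite ι] [NontriviallyNormedField 𝕜]
    [NormedAddCommGroup E] [NormedSpace 𝕜 E] [NormedAddCommGroup F] [NormedSpace 𝕜 F]
    (φ : ContinuousMultilinearMap 𝕜 (fun _ : ι => E) F) {s : Set E}
    (hs : (Submodule.span 𝕜 s).topologicalClosure = ⊤)
    (hφ : ∀ v : ι → E, (∀ j, v j ∈ s) → φ v = 0) : φ = 0 := by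
  classical
  have := Fintype.ofFinite ι
  suffices h : ∀ (J : Finset ι) (v : ι → E), (∀ j ∉ J, v j ∈ s) → φ v = 0 from
    ContinuousMultilinearMap.ext fun v => h Finset.univ v fun j hj => (hj (Finset.mem_univ j)).elim
  intro J
  induction J using Finset.induction_on with
  | empty => exact fun v hv => hφ v fun j => hv j (Finset.notMem_empty j)
  | insert j J hj ih =>
    intro v hv
    have hslot : φ.toContinuousLinearMap v j = 0 := by
      refine ContinuousLinearMap.ext_on (s := s) ?_ fun y hy => ih _ fun i hi => ?_
      · rw [dense_iff_closure_eq, ← Submodule.topologicalClosure_coe, hs, Submodule.top_coe]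
      · obtain rfl | hij := eq_or_ne i j
        · rwa [Function.update_self]
        · rw [Function.update_of_ne hij]
          exact hv i (Finset.mem_insert.not.mpr (not_or.mpr ⟨hij, hi⟩))
    simpa only [ContinuousMultilinearMap.toContinuousLinearMap_apply, Function.update_eq_self,
      _root_.zero_apply] using DFunLike.congr_fun hslot (v j)

variable {H : Type*} [NormedAddCommGroup H] [InnerProductSpace ℂ H] {ι : Type*}

theorem orthonormal_tprod {v : ι → H} (hv : Orthonormal ℂ v) (m : ℕ) :
    Orthonormal ℂ fun α : Fin m → ι => tprod fun j => v (α j) := by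
  classical
  rw [orthonormal_iff_ite] at hv ⊢
  intro α β
  simp only [inner_tprod, hv, Finset.prod_ite_zero, Finset.prod_const_one, Finset.mem_univ,
    true_imp_iff, funext_iff]

theorem orthogonal_span_tprod (b : HilbertBasis ι ℂ H) (m : ℕ) :
    (Submodule.span ℂ (Set.range fun α : Fin m → ι => tprod fun j => b (α j)))ᗮ = ⊥ := by
  refine (Submodule.eq_bot_iff _).mpr fun x hx => ext_inner_tprod fun v => ?_
  have hzero : (innerSL ℂ x).compContinuousMultilinearMap (tprodMultilinear H m) = 0 := by
    refine eq_zero_of_dense_span _ b.dense_span fun w hw => ?_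
    choose α hα using hw
    exact (Submodule.mem_orthogonal' _ _).mp hx _
      (Submodule.subset_span ⟨α, congrArg tprod (funext hα)⟩)
  rw [inner_zero_left]
  exact DFunLike.congr_fun hzero v

/-- The product basis `e_{α 1} ⊗ ⋯ ⊗ e_{α m}` of the Hilbert tensor power, for a Hilbert basis
`(e_j)` of the one-particle space. -/
noncomputable def tensorBasis (b : HilbertBasis ι ℂ H) (m : ℕ) :
    HilbertBasis (Fin m → ι) ℂ (TensorPow H m) :=
  HilbertBasis.mkOfOrthogonalEqBot (orthonormal_tprod b.orthonormal m) (orthogonal_span_tprod b m)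

theorem tensorBasis_apply (b : HilbertBasis ι ℂ H) (m : ℕ) (α : Fin m → ι) :
    tensorBasis b m α = tprod fun j => b (α j) := by
  rw [tensorBasis, HilbertBasis.coe_mkOfOrthogonalEqBot]

theorem append_tensorBasis (b : HilbertBasis ι ℂ H) {k m : ℕ} (α : Fin m → ι) (β : Fin k → ι) :
    append k (fun j => b (α j)) (tensorBasis b k β) = tensorBasis b (k + m) (Fin.append β α) := by
  rw [tensorBasis_apply, tensorBasis_apply, append_tprod]
  refine congrArg tprod (funext fun i => Fin.addCases (fun j => ?_) (fun j => ?_) i)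
  · rw [Fin.append_left, Fin.append_left]
  · rw [Fin.append_right, Fin.append_right]

theorem hasSum_norm_adjoint_append_sq (b : HilbertBasis ι ℂ H) (k m : ℕ)
    (y : TensorPow H (k + m)) :
    HasSum (fun α : Fin m → ι => ‖(append k fun j => b (α j)).adjoint y‖ ^ 2) (‖y‖ ^ 2) := by
  have h := hasSum_norm_inner_sq (tensorBasis b (k + m)) y
  rw [← ((Equiv.prodComm (Fin m → ι) (Fin k → ι)).trans (Fin.appendEquiv k m)).hasSum_iff] at h
  refine h.prod_fiberwise fun α => ?_
  refine (hasSum_norm_inner_sq (tensorBasis b k) _).congr_fun fun β => ?_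
  rw [ContinuousLinearMap.adjoint_inner_right, append_tensorBasis]
  rfl

end ProductBasis

/-! ### Reduced density matrices as expectation values -/

section PartialTrace

variable {H : Type*} [NormedAddCommGroup H] [InnerProductSpace ℂ H] [CompleteSpace H]
  {E : Type*} [NormedAddCommGroup E] [InnerProductSpace ℂ E] [CompleteSpace E] {κ : Type*}
  {k m : ℕ}

theorem summable_adjoint_comp_append (e : HilbertBasis κ ℂ E) {R : TensorPow H (k + m) →L[ℂ] E}
    (hR : Summable fun i => ‖R.adjoint (e i)‖ ^ 2) :
    Summable fun α : Fin m → basisIndex H =>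
      (append k fun j => someBasis H (α j)).adjoint ∘L (R.adjoint ∘L R) ∘L
        append k fun j => someBasis H (α j) := by
  let V (α : Fin m → basisIndex H) : TensorPow H k →L[ℂ] TensorPow H (k + m) :=
    append k fun j => someBasis H (α j)
  have hpartial (y : TensorPow H (k + m)) := hasSum_norm_adjoint_append_sq (someBasis H) k m y
  have hdouble : Summable fun p : κ × (Fin m → basisIndex H) =>
      ‖(V p.2).adjoint (R.adjoint (e p.1))‖ ^ 2 := by
    refine (summable_prod_of_nonneg fun p => sq_nonneg _).mpr
      ⟨fun i => (hpartial (R.adjoint (e i))).summable, ?_⟩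
    simpa only [V, (hpartial _).tsum_eq] using hR
  obtain ⟨hrow, hsum⟩ := (summable_prod_of_nonneg fun p => sq_nonneg _).mp hdouble.prod_symm
  refine Summable.of_norm_bounded hsum fun α => ?_
  have hadjoint : (R ∘L V α).adjoint = (V α).adjoint ∘L R.adjoint :=
    ContinuousLinearMap.adjoint_comp _ _
  have hnorm := norm_sq_le_tsum_adjoint e (R ∘L V α) (by rw [hadjoint]; exact hrow α)
  rw [sq, ← ContinuousLinearMap.norm_adjoint_comp_self, hadjoint] at hnorm
  exact hnorm

theorem inner_partialTrace (e : HilbertBasis κ ℂ E) {R : TensorPow H (k + m) →L[ℂ] E}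
    (hR : Summable fun i => ‖R.adjoint (e i)‖ ^ 2) (x y : TensorPow H k) :
    ⟪y, partialTrace k m (R.adjoint ∘L R) x⟫_ℂ
      = ∑' α : Fin m → basisIndex H, ⟪R (append k (fun j => someBasis H (α j)) y),
          R (append k (fun j => someBasis H (α j)) x)⟫_ℂ := by
  refine ((innerSL ℂ y ∘L ContinuousLinearMap.apply ℂ (TensorPow H k) x).map_tsum
    (summable_adjoint_comp_append e hR)).trans (tsum_congr fun α => ?_)
  change ⟪y, (append k _).adjoint (R.adjoint (R (append k _ x)))⟫_ℂ = _
  rw [ContinuousLinearMap.adjoint_inner_right, ContinuousLinearMap.adjoint_inner_right]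

end PartialTrace

section ReducedDensityMatrix

variable {H : Type*} [NormedAddCommGroup H] [InnerProductSpace ℂ H] {k m : ℕ}

theorem IsBosonicState.exists_eq_adjoint_comp {N : ℕ} {Γ : SymPow H N →L[ℂ] SymPow H N}
    (h : IsBosonicState Γ) : ∃ S : SymPow H N →L[ℂ] SymPow H N, Γ = S.adjoint ∘L S ∧
      HasSum (fun i => ‖S.adjoint (someBasis (SymPow H N) i)‖ ^ 2) 1 := by
  have h0 : 0 ≤ Γ := (ContinuousLinearMap.nonneg_iff_isPositive Γ).mpr h.isPositive
  obtain ⟨S, hadj, hS⟩ : ∃ S : SymPow H N →L[ℂ] SymPow H N, S.adjoint = S ∧ S ∘L S = Γ :=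
    ⟨CFC.sqrt Γ, ((ContinuousLinearMap.nonneg_iff_isPositive _).mp
      (CFC.sqrt_nonneg Γ)).isSelfAdjoint, CFC.sqrt_mul_sqrt_self Γ h0⟩
  refine ⟨S, by rw [hadj, hS], ?_⟩
  have hterm (x : SymPow H N) : ⟪x, Γ x⟫_ℂ = ((‖S.adjoint x‖ ^ 2 : ℝ) : ℂ) := by
    rw [← hS, ContinuousLinearMap.comp_apply, ← ContinuousLinearMap.adjoint_inner_left, hadj,
      inner_self_eq_norm_sq_to_K, Complex.ofReal_pow]
    rfl
  have hsummable := h.isTraceClass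
  have htrace := h.trace_eq_one
  rw [IsTraceClass, CFC.abs_of_nonneg Γ h0] at hsummable
  simp only [hterm, Complex.ofReal_re] at hsummable
  simp only [trace, hterm, ← Complex.ofReal_tsum] at htrace
  exact Complex.ofReal_eq_one.mp htrace ▸ hsummable.hasSum

theorem adjoint_symIncl_append_tprod (f : H) (v : Fin m → H) :
    (symIncl H (k + m)).adjoint (append k v (tprod fun _ => f))
      = symAppend f (Nat.add_comm m k) (tprod v) := by
  refine ext_inner_powTensor fun u => ?_
  rw [ContinuousLinearMap.adjoint_inner_right, symIncl_powTensor,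
    ← ContinuousLinearMap.adjoint_inner_left (symAppend f _), adjoint_symAppend_powTensor,
    inner_smul_left, append_tprod, inner_tprod, inner_tprod, Fin.prod_univ_add]
  simp only [Fin.append_left, Fin.append_right, Finset.prod_const, Finset.card_univ,
    Fintype.card_fin, map_pow, inner_conj_symm]

theorem symAppend_comp_adjoint_symAppend (f g : H) {n : ℕ} (h : m + k = n) :
    symAppend f h ∘L (symAppend g h).adjoint = kBody f g k n := by
  refine clm_ext_inner_powTensor fun v u => ?_
  rw [ContinuousLinearMap.comp_apply, ← ContinuousLinearMap.adjoint_inner_left,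
    adjoint_symAppend_powTensor, adjoint_symAppend_powTensor, inner_smul_left, inner_smul_right,
    inner_tprod]
  subst h
  rw [inner_powTensor_kBody, map_pow, inner_conj_symm, Finset.prod_const, Finset.card_univ,
    Fintype.card_fin, ← mul_assoc, mul_pow]

variable [CompleteSpace H]
  {E : Type*} [NormedAddCommGroup E] [InnerProductSpace ℂ E] [CompleteSpace E] {κ : Type*}

theorem inner_powTensor_reducedDensityMatrix (e : HilbertBasis κ ℂ E)
    {S : SymPow H (k + m) →L[ℂ] E} (hS : Summable fun i => ‖S.adjoint (e i)‖ ^ 2) (f g : H) :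
    ⟪powTensor g k, reducedDensityMatrix k m (S.adjoint ∘L S) (powTensor f k)⟫_ℂ
      = ∑' i, ⟪S.adjoint (e i), kBody f g k (k + m) (S.adjoint (e i))⟫_ℂ := by
  let A (f : H) : TensorPow H m →L[ℂ] E := S ∘L symAppend f (Nat.add_comm m k)
  have hA (f : H) : Summable fun i => ‖(A f).adjoint (e i)‖ ^ 2 := by
    simp only [A, ContinuousLinearMap.adjoint_comp, ContinuousLinearMap.comp_apply]
    refine (hS.mul_left (‖(symAppend f (Nat.add_comm m k)).adjoint‖ ^ 2)).of_nonneg_of_le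
      (fun i => sq_nonneg _) fun i => ?_
    rw [← mul_pow]
    exact pow_le_pow_left₀ (norm_nonneg _) (ContinuousLinearMap.le_opNorm _ _) 2
  have hR : Summable fun i => ‖(S ∘L (symIncl H (k + m)).adjoint).adjoint (e i)‖ ^ 2 := by
    simpa only [ContinuousLinearMap.adjoint_comp, ContinuousLinearMap.adjoint_adjoint,
      ContinuousLinearMap.comp_apply, norm_symIncl_apply] using hS
  have hΓ : symIncl H (k + m) ∘L (S.adjoint ∘L S) ∘L (symIncl H (k + m)).adjoint
      = (S ∘L (symIncl H (k + m)).adjoint).adjoint ∘L (S ∘L (symIncl H (k + m)).adjoint) := by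
    rw [ContinuousLinearMap.adjoint_comp, ContinuousLinearMap.adjoint_adjoint]
    rfl
  calc ⟪powTensor g k, reducedDensityMatrix k m (S.adjoint ∘L S) (powTensor f k)⟫_ℂ
      = ∑' α, ⟪A g (tensorBasis (someBasis H) m α), A f (tensorBasis (someBasis H) m α)⟫_ℂ := by
        rw [reducedDensityMatrix, ContinuousLinearMap.comp_apply,
          ContinuousLinearMap.adjoint_inner_right, hΓ, ContinuousLinearMap.comp_apply,
          inner_partialTrace e hR]
        simp only [symIncl_powTensor, ContinuousLinearMap.comp_apply,
          adjoint_symIncl_append_tprod, tensorBasis_apply, A]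
    _ = ∑' i, ⟪(A f).adjoint (e i), (A g).adjoint (e i)⟫_ℂ :=
        tsum_inner_eq_tsum_inner_adjoint _ e _ _ (hA g) (hA f)
    _ = ∑' i, ⟪S.adjoint (e i), kBody f g k (k + m) (S.adjoint (e i))⟫_ℂ := by
        simp only [A, ContinuousLinearMap.adjoint_comp, ContinuousLinearMap.comp_apply,
          ContinuousLinearMap.adjoint_inner_left, ← symAppend_comp_adjoint_symAppend f g
            (Nat.add_comm m k)]

end ReducedDensityMatrix

/-! ### States on C*-algebras -/

section States

open scoped ComplexOrder ENNReal

universe u v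

/-- States on a unital star algebra over `ℂ`: positive linear functionals `ω` with `ω 1 = 1`. -/
structure IsState {A : Type*} [Ring A] [StarRing A] [Algebra ℂ A] (ω : A →ₗ[ℂ] ℂ) : Prop where
  nonneg : ∀ a, 0 ≤ ω (star a * a)
  map_one : ω 1 = 1

namespace IsState

section StarAlgebra

variable {A B : Type*} [Ring A] [StarRing A] [Algebra ℂ A] [Ring B] [StarRing B] [Algebra ℂ B]
  {ω : A →ₗ[ℂ] ℂ}

theorem nontrivial (hω : IsState ω) : Nontrivial A :=
  ⟨1, 0, fun h => one_ne_zero (hω.map_one.symm.trans ((congrArg ω h).trans ω.map_zero))⟩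

theorem apply_nonneg [PartialOrder A] [StarOrderedRing A] (hω : IsState ω) {a : A} (ha : 0 ≤ a) :
    0 ≤ ω a := by
  rw [StarOrderedRing.nonneg_iff] at ha
  induction ha using AddSubmonoid.closure_induction with
  | mem a ha => obtain ⟨b, rfl⟩ := ha; exact hω.nonneg b
  | zero => rw [map_zero]
  | add a b _ _ ha hb => rw [map_add]; exact add_nonneg ha hb

theorem comp (hω : IsState ω) (φ : B →⋆ₐ[ℂ] A) :
    IsState (ω ∘ₗ φ.toAlgHom.toLinearMap) where
  nonneg b := by
    change 0 ≤ ω (φ (star b * b))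
    rw [map_mul, StarHomClass.map_star]
    exact hω.nonneg (φ b)
  map_one := (congrArg ω (_root_.map_one φ)).trans hω.map_one

end StarAlgebra

variable {A : Type u} [CStarAlgebra A] {ω : A →ₗ[ℂ] ℂ}

theorem exists_gns (hω : IsState ω) :
    ∃ (K : Type u) (_ : NormedAddCommGroup K) (_ : InnerProductSpace ℂ K) (_ : CompleteSpace K)
      (π : A →⋆ₐ[ℂ] (K →L[ℂ] K)) (Ω : K), ‖Ω‖ = 1 ∧ (∀ a, ⟪Ω, π a Ω⟫_ℂ = ω a) ∧
      ∀ a, (∀ b, ω (star (a * b) * (a * b)) = 0) → π a = 0 := by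
  let _ : PartialOrder A := CStarAlgebra.spectralOrder _
  have _ : StarOrderedRing A := CStarAlgebra.spectralOrderedRing _
  let f : A →ₚ[ℂ] ℂ := PositiveLinearMap.mk₀ ω fun _ => hω.apply_nonneg
  have hf (a : A) : f a = ω a := rfl
  have hπ (a b : A) : f.gnsStarAlgHom a ((f.toPreGNS b : f.PreGNS) : f.GNS)
      = ((f.toPreGNS (a * b) : f.PreGNS) : f.GNS) := by simp
  refine ⟨f.GNS, inferInstance, inferInstance, inferInstance, f.gnsStarAlgHom,
    ((f.toPreGNS 1 : f.PreGNS) : f.GNS), ?_, fun a => ?_, fun a ha => ?_⟩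
  · have hnorm := f.preGNS_norm_sq (f.toPreGNS 1)
    rw [PositiveLinearMap.ofPreGNS_toPreGNS, hf, star_one, mul_one, hω.map_one] at hnorm
    rw [UniformSpace.Completion.norm_coe, ← pow_eq_one_iff_of_nonneg (norm_nonneg _) two_ne_zero]
    exact_mod_cast hnorm
  · rw [hπ, UniformSpace.Completion.inner_coe, f.preGNS_inner_def]
    simp only [PositiveLinearMap.ofPreGNS_toPreGNS, star_one, one_mul, mul_one, hf]
  · refine ContinuousLinearMap.ext fun y => UniformSpace.Completion.induction_on (α := f.PreGNS) y
      (isClosed_eq (ContinuousLinearMap.continuous _) (ContinuousLinearMap.continuous _))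
      fun b => ?_
    have hnorm := f.preGNS_norm_sq (f.toPreGNS (a * f.ofPreGNS b))
    rw [PositiveLinearMap.ofPreGNS_toPreGNS, hf, ha] at hnorm
    rw [← f.toPreGNS_ofPreGNS b, hπ, zero_apply, ← norm_eq_zero, UniformSpace.Completion.norm_coe,
      ← sq_eq_zero_iff]
    exact_mod_cast hnorm

theorem norm_apply_le (hω : IsState ω) (a : A) : ‖ω a‖ ≤ ‖a‖ := by
  obtain ⟨K, _, _, _, π, Ω, hΩ, hπ, -⟩ := hω.exists_gns
  calc ‖ω a‖ = ‖⟪Ω, π a Ω⟫_ℂ‖ := by rw [hπ]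
    _ ≤ ‖Ω‖ * (‖π a‖ * ‖Ω‖) :=
      (norm_inner_le_norm _ _).trans (by gcongr; exact (π a).le_opNorm Ω)
    _ = ‖π a‖ := by rw [hΩ, one_mul, mul_one]
    _ ≤ ‖a‖ := NonUnitalStarAlgHom.norm_apply_le π a

theorem map_star (hω : IsState ω) (a : A) : ω (star a) = conj (ω a) := by
  let _ : PartialOrder A := CStarAlgebra.spectralOrder _
  have _ : StarOrderedRing A := CStarAlgebra.spectralOrderedRing _
  exact StarHomClass.map_star (PositiveLinearMap.mk₀ ω fun _ => hω.apply_nonneg) a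

end IsState

section Expectation

variable {E : Type*} [NormedAddCommGroup E] [InnerProductSpace ℂ E] {κ : Type*}

theorem norm_inner_apply_le (D : E →L[ℂ] E) (x : E) : ‖⟪x, D x⟫_ℂ‖ ≤ ‖D‖ * ‖x‖ ^ 2 :=
  calc ‖⟪x, D x⟫_ℂ‖ ≤ ‖x‖ * ‖D x‖ := norm_inner_le_norm _ _
    _ ≤ ‖x‖ * (‖D‖ * ‖x‖) := mul_le_mul_of_nonneg_left (D.le_opNorm x) (norm_nonneg _)
    _ = ‖D‖ * ‖x‖ ^ 2 := by ring

theorem summable_inner_apply {w : κ → E} (hw : Summable fun i => ‖w i‖ ^ 2) (D : E →L[ℂ] E) :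
    Summable fun i => ⟪w i, D (w i)⟫_ℂ :=
  Summable.of_norm_bounded (hw.mul_left ‖D‖) fun i => norm_inner_apply_le D (w i)

/-- The functional `D ↦ ∑ᵢ ⟪wᵢ, D wᵢ⟫`, that is `D ↦ Tr (ρ D)` for the density matrix
`ρ = ∑ᵢ |wᵢ⟩⟨wᵢ|`. -/
noncomputable def expectation (w : κ → E) (hw : Summable fun i => ‖w i‖ ^ 2) :
    (E →L[ℂ] E) →ₗ[ℂ] ℂ where
  toFun D := ∑' i, ⟪w i, D (w i)⟫_ℂ
  map_add' D D' := by
    simp only [add_apply, inner_add_right]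
    exact (summable_inner_apply hw D).tsum_add (summable_inner_apply hw D')
  map_smul' c D := by
    simp only [smul_apply, inner_smul_right, RingHom.id_apply, smul_eq_mul]
    exact tsum_mul_left

theorem expectation_apply (w : κ → E) (hw : Summable fun i => ‖w i‖ ^ 2) (D : E →L[ℂ] E) :
    expectation w hw D = ∑' i, ⟪w i, D (w i)⟫_ℂ := rfl

theorem isState_expectation [CompleteSpace E] {w : κ → E} (hw : HasSum (fun i => ‖w i‖ ^ 2) 1) :
    IsState (expectation w hw.summable) where
  nonneg D := tsum_nonneg fun i => by
    rw [mul_apply_eq_comp, ContinuousLinearMap.star_eq_adjoint,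
      ContinuousLinearMap.adjoint_inner_right, inner_self_eq_norm_sq_to_K, ← RCLike.ofReal_pow]
    exact Complex.zero_le_real.mpr (sq_nonneg _)
  map_one := by
    simp only [expectation_apply, one_apply_eq_self, inner_self_eq_norm_sq_to_K,
      ← RCLike.ofReal_pow, ← RCLike.ofReal_tsum, hw.tsum_eq, RCLike.ofReal_one]

end Expectation

section Limit

noncomputable instance lpInftyCStarAlgebra {I : Type*} {B : I → Type*} [∀ i, Nontrivial (B i)]
    [∀ i, CStarAlgebra (B i)] : CStarAlgebra (lp B ∞) where

variable {I : Type u} {B : I → Type v} [∀ i, Nontrivial (B i)] [∀ i, CStarAlgebra (B i)]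

theorem IsState.exists_tendsto_ultrafilter {φ : ∀ i, B i →ₗ[ℂ] ℂ} (hφ : ∀ i, IsState (φ i))
    (l : Ultrafilter I) : ∃ ω : lp B ∞ →ₗ[ℂ] ℂ, IsState ω ∧
      ∀ x : lp B ∞, Tendsto (fun i => φ i (x i)) l (𝓝 (ω x)) := by
  have hlim (x : lp B ∞) : ∃ z, Tendsto (fun i => φ i (x i)) l (𝓝 z) := by
    obtain ⟨z, -, hz⟩ := (isCompact_closedBall (0 : ℂ) ‖x‖).ultrafilter_le_nhds
      (l.map fun i => φ i (x i)) <| le_principal_iff.mpr <|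
        eventually_map.mpr <| Eventually.of_forall fun i => mem_closedBall_zero_iff.mpr <|
          ((hφ i).norm_apply_le _).trans (lp.norm_apply_le_norm ENNReal.top_ne_zero x i)
    exact ⟨z, hz⟩
  choose ω hω using hlim
  refine ⟨{ toFun := ω, map_add' := fun x y => ?_, map_smul' := fun c x => ?_ }, ⟨fun x => ?_, ?_⟩,
    hω⟩
  · refine tendsto_nhds_unique (hω (x + y)) (((hω x).add (hω y)).congr fun i => ?_)
    rw [lp.coeFn_add, Pi.add_apply, map_add]
  · refine tendsto_nhds_unique (hω (c • x)) (((hω x).const_smul c).congr fun i => ?_)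
    rw [lp.coeFn_smul, Pi.smul_apply, map_smul]
  · refine ge_of_tendsto (hω (star x * x)) (Eventually.of_forall fun i => ?_)
    rw [lp.infty_coeFn_mul, Pi.mul_apply, lp.coeFn_star, Pi.star_apply]
    exact (hφ i).nonneg _
  · exact tendsto_nhds_unique (hω 1) (tendsto_const_nhds.congr fun i => (hφ i).map_one.symm)

theorem IsState.exists_limit {φ : ∀ i, B i →ₗ[ℂ] ℂ} (hφ : ∀ i, IsState (φ i)) (l : Filter I)
    [l.NeBot] :
    ∃ (A : Type (max u v)) (_ : CStarAlgebra A) (π : lp B ∞ →⋆ₐ[ℂ] A) (ω : A →ₗ[ℂ] ℂ), IsState ω ∧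
      (∀ x : lp B ∞, Tendsto (fun i => ‖x i‖) l (𝓝 0) → π x = 0) ∧
      ∀ (x : lp B ∞) (z : ℂ), Tendsto (fun i => φ i (x i)) l (𝓝 z) → ω (π x) = z := by
  obtain ⟨ω, hω, hlim⟩ := exists_tendsto_ultrafilter hφ (Ultrafilter.of l)
  obtain ⟨K, _, _, _, π, Ω, hΩ, hπ, hker⟩ := hω.exists_gns
  have hvector : HasSum (fun _ : Unit => ‖Ω‖ ^ 2) 1 := by
    simpa only [hΩ, one_pow] using hasSum_unique fun _ : Unit => (1 : ℝ)
  refine ⟨K →L[ℂ] K, inferInstance, π, expectation _ hvector.summable, isState_expectation hvector,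
    fun x hx => hker x fun y => ?_, fun x z hz => ?_⟩
  · refine tendsto_nhds_unique (hlim _) (Tendsto.mono_left ?_ (Ultrafilter.of_le l))
    refine squeeze_zero_norm (a := fun i => (‖x i‖ * ‖y‖) ^ 2) (fun i => ?_) <| by
      simpa only [zero_mul, ne_eq, OfNat.ofNat_ne_zero, not_false_eq_true, zero_pow]
        using (hx.mul_const ‖y‖).pow 2
    refine ((hφ i).norm_apply_le _).trans ?_
    rw [lp.infty_coeFn_mul, Pi.mul_apply, lp.coeFn_star, Pi.star_apply,
      CStarRing.norm_star_mul_self, ← sq, lp.infty_coeFn_mul, Pi.mul_apply]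
    gcongr
    exact (norm_mul_le _ _).trans (mul_le_mul_of_nonneg_left
      (lp.norm_apply_le_norm ENNReal.top_ne_zero _ i) (norm_nonneg _))
  · rw [expectation_apply, tsum_fintype, Fintype.sum_unique, hπ]
    exact tendsto_nhds_unique (hlim x) (hz.mono_left (Ultrafilter.of_le l))

end Limit

end States

section Representation

open scoped ComplexOrder CompactlySupported

universe u

namespace IsState

theorem exists_measure_continuousMap {X : Type*} [TopologicalSpace X] [CompactSpace X] [T2Space X]
    [MeasurableSpace X] [BorelSpace X] {ω : C(X, ℂ) →ₗ[ℂ] ℂ} (hω : IsState ω) :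
    ∃ ν : Measure X, IsProbabilityMeasure ν ∧ ∀ g, ω g = ∫ x, g x ∂ν := by
  let ofReal : C(X, ℝ) →L[ℝ] C(X, ℂ) := Complex.ofRealCLM.compLeftContinuous ℝ X
  let forget : C_c(X, ℝ) →ₗ[ℝ] C(X, ℝ) :=
    { toFun := fun h => h.toContinuousMap, map_add' := fun _ _ => rfl, map_smul' := fun _ _ => rfl }
  let Λ : C_c(X, ℝ) →ₚ[ℝ] ℝ := PositiveLinearMap.mk₀
    (Complex.reLm ∘ₗ ω.restrictScalars ℝ ∘ₗ ofReal.toLinearMap ∘ₗ forget) fun h hh =>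
      (Complex.le_def.mp (hω.apply_nonneg (a := ofReal h.toContinuousMap) fun x =>
        Complex.zero_le_real.mpr (hh x))).1
  let ν := RealRMK.rieszMeasure Λ
  have hreal (h : C(X, ℝ)) : ω (ofReal h) = ((∫ x, h x ∂ν : ℝ) : ℂ) := by
    have hself : star (ofReal h) = ofReal h := ContinuousMap.ext fun x => Complex.conj_ofReal _
    rw [← Complex.conj_eq_iff_re.mp ((hω.map_star _).symm.trans (congrArg ω hself))]
    exact congrArg _ (RealRMK.integral_rieszMeasure Λ ⟨h, .of_compactSpace _⟩).symm
  have hcomplex (g : C(X, ℂ)) : ω g = ∫ x, g x ∂ν := by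
    let re : C(X, ℝ) := ⟨fun x => (g x).re, by fun_prop⟩
    let im : C(X, ℝ) := ⟨fun x => (g x).im, by fun_prop⟩
    have hdecomp : g = ofReal re + Complex.I • ofReal im :=
      ContinuousMap.ext fun x => ((Complex.re_add_im (g x)).symm.trans (by rw [mul_comm]; rfl))
    calc ω g = ω (ofReal re) + Complex.I * ω (ofReal im) := by
          conv_lhs => rw [hdecomp, map_add, map_smul, smul_eq_mul]
      _ = ∫ x, g x ∂ν := by
          rw [hreal, hreal, mul_comm]
          exact integral_re_add_im ((BoundedContinuousFunction.mkOfCompact g).integrable ν)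
  refine ⟨ν, ⟨?_⟩, hcomplex⟩
  have hone : ((ν.real Set.univ : ℝ) : ℂ) = 1 := by
    rw [← hω.map_one, hcomplex]
    simp
  exact (ENNReal.toReal_eq_one_iff _).mp (Complex.ofReal_eq_one.mp hone)

theorem exists_measure_characterSpace {C : Type*} [CommCStarAlgebra C]
    [MeasurableSpace (WeakDual.characterSpace ℂ C)] [BorelSpace (WeakDual.characterSpace ℂ C)]
    {ω : C →ₗ[ℂ] ℂ} (hω : IsState ω) :
    ∃ ν : Measure (WeakDual.characterSpace ℂ C), IsProbabilityMeasure ν ∧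
      ∀ c, ω c = ∫ φ : WeakDual.characterSpace ℂ C, φ c ∂ν := by
  let e := gelfandStarTransform C
  obtain ⟨ν, hν, hint⟩ := IsState.exists_measure_continuousMap <|
    hω.comp (e.symm : C(WeakDual.characterSpace ℂ C, ℂ) →⋆ₐ[ℂ] C)
  refine ⟨ν, hν, fun c => ?_⟩
  calc ω c = ω (e.symm (e c)) := by rw [e.symm_apply_apply]
    _ = ∫ φ, e c φ ∂ν := hint (e c)

end IsState

theorem exists_commCStarAlgebra_of_commute {A : Type u} [CStarAlgebra A] {s : Set A}
    (hcomm : ∀ a ∈ s, ∀ b ∈ s, a * b = b * a) (hstar : ∀ a ∈ s, star a ∈ s) :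
    ∃ (C : Type u) (_ : CommCStarAlgebra C) (ι : C →⋆ₐ[ℂ] A),
      Function.Injective ι ∧ s ⊆ Set.range ι := by
  let C := (StarAlgebra.adjoin ℂ s).topologicalClosure
  have hadjoin : IsMulCommutative (StarAlgebra.adjoin ℂ s) :=
    StarAlgebra.isMulCommutative_adjoin ℂ hcomm fun a ha b hb => hcomm a ha _ (hstar b hb)
  let _ : CStarAlgebra C :=
    StarSubalgebra.cstarAlgebra C (h_closed := StarSubalgebra.isClosed_topologicalClosure _)
  have hmul : ∀ a b : C, a * b = b * a :=
    (StarSubalgebra.commRingTopologicalClosure (StarAlgebra.adjoin ℂ s)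
      fun a b => hadjoin.is_comm.comm a b).mul_comm
  exact ⟨C, { mul_comm := hmul }, C.subtype, Subtype.val_injective, fun a ha =>
    ⟨⟨a, StarSubalgebra.le_topologicalClosure _ (StarAlgebra.subset_adjoin ℂ _ ha)⟩, rfl⟩⟩

end Representation

/-! ### Rank one forms with values in a C*-algebra -/

section RankOneForm

variable {H : Type*} [NormedAddCommGroup H] [InnerProductSpace ℂ H]

/-- `T` has the properties of the form `(f, g) ↦ ⟪g, u⟫ ⟪u, f⟫` of the operator `|u⟩⟨u|`, where
`‖u‖ ≤ 1`, but takes its values in a C*-algebra. It is the algebraic counterpart of a random vector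
of the unit ball. Positivity of `T f f` is encoded in `norm_sub_le`, so as not to need an order. -/
structure IsRankOneForm {A : Type*} [CStarAlgebra A] (T : H → H → A) : Prop where
  add_left : ∀ f f' g, T (f + f') g = T f g + T f' g
  smul_left : ∀ (c : ℂ) f g, T (c • f) g = c • T f g
  star_apply : ∀ f g, star (T f g) = T g f
  exchange : ∀ f g f' g', T f g * T f' g' = T f g' * T f' g
  norm_le : ∀ f g, ‖T f g‖ ≤ ‖f‖ * ‖g‖
  norm_sub_le : ∀ f, ‖((‖f‖ ^ 2 : ℝ) : ℂ) • 1 - T f f‖ ≤ ‖f‖ ^ 2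

namespace IsRankOneForm

section Algebra

variable {A B : Type*} [CStarAlgebra A] [CStarAlgebra B] {T : H → H → A}

theorem mul_comm (hT : IsRankOneForm T) (f g f' g' : H) :
    T f g * T f' g' = T f' g' * T f g := by
  have hstar := congrArg star (hT.exchange g' f' g f)
  simp only [star_mul, hT.star_apply] at hstar
  rw [hstar, hT.exchange]

variable {F : Type*} [FunLike F A B] [AlgHomClass F ℂ A B] [StarHomClass F A B]

theorem map (hT : IsRankOneForm T) (φ : F) : IsRankOneForm fun f g => φ (T f g) where
  add_left f f' g := by rw [hT.add_left, map_add]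
  smul_left c f g := by rw [hT.smul_left, map_smul]
  star_apply f g := by rw [← map_star, hT.star_apply]
  exchange f g f' g' := by rw [← map_mul, hT.exchange, map_mul]
  norm_le f g := (NonUnitalStarAlgHom.norm_apply_le φ _).trans (hT.norm_le f g)
  norm_sub_le f := by
    rw [← map_one φ, ← map_smul, ← map_sub]
    exact (NonUnitalStarAlgHom.norm_apply_le φ _).trans (hT.norm_sub_le f)

theorem of_map {φ : F} (hφ : Function.Injective φ) (hT : IsRankOneForm fun f g => φ (T f g)) :
    IsRankOneForm T where
  add_left f f' g := hφ (by rw [map_add, hT.add_left])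
  smul_left c f g := hφ (by rw [map_smul, hT.smul_left])
  star_apply f g := hφ (by rw [map_star, hT.star_apply])
  exchange f g f' g' := hφ (by rw [map_mul, map_mul, hT.exchange])
  norm_le f g := (NonUnitalStarAlgHom.norm_map φ hφ _).symm.trans_le (hT.norm_le f g)
  norm_sub_le f := by
    rw [← NonUnitalStarAlgHom.norm_map φ hφ, map_sub, map_smul, map_one]
    exact hT.norm_sub_le f

end Algebra

section Scalar

variable {z : H → H → ℂ}

theorem ofReal_re_apply_self (hz : IsRankOneForm z) (f : H) : ((z f f).re : ℂ) = z f f :=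
  Complex.conj_eq_iff_re.mp (hz.star_apply f f)

theorem re_apply_self_nonneg (hz : IsRankOneForm z) (f : H) : 0 ≤ (z f f).re := by
  have h := hz.norm_sub_le f
  rw [smul_eq_mul, mul_one, ← hz.ofReal_re_apply_self, ← Complex.ofReal_sub, Complex.norm_real,
    Real.norm_eq_abs] at h
  linarith [le_abs_self (‖f‖ ^ 2 - (z f f).re)]

theorem eq_zero_of_apply_self_eq_zero (hz : IsRankOneForm z) {d : H} (hd : z d d = 0) (f : H) :
    z f d = 0 := by
  have h := hz.exchange f d d f
  rwa [hd, mul_zero, ← hz.star_apply f d, Complex.star_def, Complex.mul_conj,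
    Complex.ofReal_eq_zero, Complex.normSq_eq_zero] at h

theorem eq_inner_mul_inner (hz : IsRankOneForm z) {d v : H} (hd : z d d ≠ 0)
    (hv : ∀ f, ⟪v, f⟫_ℂ = z f d) (f g : H) :
    z f g = ⟪g, (((√(z d d).re)⁻¹ : ℝ) : ℂ) • v⟫_ℂ * ⟪(((√(z d d).re)⁻¹ : ℝ) : ℂ) • v, f⟫_ℂ := by
  have hsq : ((√(z d d).re : ℝ) : ℂ) * ((√(z d d).re : ℝ) : ℂ) = z d d := by
    rw [← Complex.ofReal_mul, Real.mul_self_sqrt (hz.re_apply_self_nonneg d),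
      hz.ofReal_re_apply_self]
  have hne : ((√(z d d).re : ℝ) : ℂ) ≠ 0 := left_ne_zero_of_mul (hsq.trans_ne hd)
  have hv' : ⟪g, v⟫_ℂ = z d g := by
    rw [← inner_conj_symm, hv, ← hz.star_apply g d, Complex.star_def]
  have hexchange := hz.exchange f g d d
  rw [inner_smul_left, inner_smul_right, Complex.conj_ofReal, hv, hv', Complex.ofReal_inv]
  field_simp
  rw [← hsq] at hexchange
  linear_combination hexchange

theorem norm_le_one_of_eq_inner_mul_inner (hz : IsRankOneForm z) {u : H}
    (hu : ∀ f g, z f g = ⟪g, u⟫_ℂ * ⟪u, f⟫_ℂ) : ‖u‖ ≤ 1 := by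
  have h := hz.norm_le u u
  rw [hu, inner_self_eq_norm_sq_to_K, norm_mul, norm_pow, RCLike.norm_ofReal, abs_norm] at h
  by_contra! hlt
  nlinarith [mul_pos (sub_pos.mpr hlt) (sub_pos.mpr hlt)]

variable [CompleteSpace H]

theorem exists_inner_eq (hz : IsRankOneForm z) (g : H) : ∃ v : H, ∀ f, ⟪v, f⟫_ℂ = z f g := by
  let L : H →L[ℂ] ℂ := LinearMap.mkContinuous
    { toFun := fun f => z f g
      map_add' := fun f f' => hz.add_left f f' g
      map_smul' := fun c f => hz.smul_left c f g } ‖g‖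
    fun f => (hz.norm_le f g).trans_eq (_root_.mul_comm _ _)
  exact ⟨(InnerProductSpace.toDual ℂ H).symm L, fun f => InnerProductSpace.toDual_symm_apply⟩

theorem eq_zero_of_dense (hz : IsRankOneForm z) {s : Set H} (hs : Dense s)
    (h : ∀ d ∈ s, z d d = 0) (f g : H) : z f g = 0 := by
  obtain ⟨v, hv⟩ := hz.exists_inner_eq g
  have hv0 : ∀ f, ⟪v, f⟫_ℂ = 0 := fun f => hs.induction
    (fun d hd => by
      rw [hv, ← hz.star_apply, hz.eq_zero_of_apply_self_eq_zero (h d hd), star_zero])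
    (isClosed_eq (continuous_const.inner continuous_id) continuous_const) f
  rw [← hv, hv0]

end Scalar

end IsRankOneForm

end RankOneForm

/-! ### Measurable selection of vectors -/

section Selection

theorem countable_of_orthonormal {𝕜 E ι : Type*} [RCLike 𝕜] [NormedAddCommGroup E]
    [InnerProductSpace 𝕜 E] [TopologicalSpace.SeparableSpace E] {v : ι → E}
    (hv : Orthonormal 𝕜 v) : Countable ι := by
  refine Pairwise.countable_of_isOpen_disjoint (s := fun i => Metric.ball (v i) (1 / 2))
    (fun i j hij => Metric.ball_disjoint_ball ?_) (fun i => Metric.isOpen_ball)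
    fun i => ⟨v i, Metric.mem_ball_self (by norm_num)⟩
  have h := norm_sub_sq (𝕜 := 𝕜) (v i) (v j)
  rw [hv.2 hij, hv.1 i, hv.1 j, map_zero] at h
  rw [dist_eq_norm]
  nlinarith [norm_nonneg (v i - v j)]

variable {H : Type*} [NormedAddCommGroup H] [InnerProductSpace ℂ H]
  [TopologicalSpace.SeparableSpace H] [CompleteSpace H] [MeasurableSpace H] [BorelSpace H]
  {X : Type*} [MeasurableSpace X]

theorem measurable_of_inner {u : X → H} (h : ∀ g, Measurable fun x => ⟪g, u x⟫_ℂ) :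
    Measurable u := by
  have := UniformSpace.secondCountable_of_separable H
  have : Countable (basisIndex H) := countable_of_orthonormal (someBasis H).orthonormal
  refine measurable_of_tendsto_metrizable' (atTop : Filter (Finset (basisIndex H)))
    (f := fun s x => ∑ i ∈ s, ⟪someBasis H i, u x⟫_ℂ • someBasis H i)
    (fun s => Finset.measurable_fun_sum s fun i _ => (h _).smul_const _)
    (tendsto_pi_nhds.mpr fun x => ?_)
  simpa only [HilbertBasis.repr_apply_apply, HasSum, SummationFilter.unconditional_filter]
    using (someBasis H).hasSum_repr (u x)

theorem IsRankOneForm.exists_measurable {z : X → H → H → ℂ} (hz : ∀ x, IsRankOneForm (z x))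
    (hm : ∀ f g, Measurable fun x => z x f g) :
    ∃ u : X → Metric.closedBall (0 : H) 1, Measurable u ∧
      ∀ x f g, z x f g = ⟪g, (u x : H)⟫_ℂ * ⟪(u x : H), f⟫_ℂ := by
  classical
  have := UniformSpace.secondCountable_of_separable H
  let d : ℕ → H := TopologicalSpace.denseSeq H
  let r : ℕ → X → ℝ := fun n x => (z x (d n) (d n)).re
  choose v hv using fun n x => (hz x).exists_inner_eq (d n)
  let w : ℕ → X → H := fun n x => (((√(r n x))⁻¹ : ℝ) : ℂ) • v n x
  have hr : ∀ n, Measurable (r n) := fun n => Complex.measurable_re.comp (hm _ _)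
  have hw : ∀ n, Measurable (w n) := fun n => measurable_of_inner fun g => by
    have hvg (x : X) : ⟪g, v n x⟫_ℂ = z x (d n) g := by
      rw [← inner_conj_symm, hv, ← (hz x).star_apply g, Complex.star_def]
    simp only [w, inner_smul_right, hvg]
    exact (Complex.measurable_ofReal.comp (hr n).sqrt.inv).mul (hm _ _)
  -- Select the first `n` with `r n x ≠ 0`. If there is none, `Nat.find` returns `0`, and
  -- `w 0 x = 0` because `0⁻¹ = 0`.
  let p : ℕ → X → Prop := fun n x => r n x ≠ 0 ∨ ∀ m, r m x = 0
  have hp : ∀ x, ∃ n, p n x := fun x => by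
    by_cases hzero : ∀ m, r m x = 0
    · exact ⟨0, .inr hzero⟩
    · exact (not_forall.mp hzero).imp fun n hn => .inl hn
  have hpm : ∀ n, MeasurableSet {x | p n x} := fun n =>
    ((hr n) (measurableSet_singleton 0)).compl.union <| by
      have hinter : {x | ∀ m, r m x = 0} = ⋂ m, {x | r m x = 0} := Set.ofPred_forall _
      change MeasurableSet {x | ∀ m, r m x = 0}
      rw [hinter]
      exact MeasurableSet.iInter fun m => hr m (measurableSet_singleton 0)
  have hrank : ∀ x f g, z x f g
      = ⟪g, w (Nat.find (hp x)) x⟫_ℂ * ⟪w (Nat.find (hp x)) x, f⟫_ℂ := fun x f g => by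
    rcases Nat.find_spec (hp x) with hne | hzero
    · exact (hz x).eq_inner_mul_inner (fun h0 => hne (congrArg Complex.re h0)) (hv _ x) f g
    · have hdense := (hz x).eq_zero_of_dense (TopologicalSpace.denseRange_denseSeq H) <| by
        rintro _ ⟨m, rfl⟩
        exact ((hz x).ofReal_re_apply_self _).symm.trans (congrArg Complex.ofReal (hzero m))
      rw [hdense, show w (Nat.find (hp x)) x = 0 by simp [w, hzero], inner_zero_right, zero_mul]
  exact ⟨fun x => ⟨w (Nat.find (hp x)) x, mem_closedBall_zero_iff.mpr
    ((hz x).norm_le_one_of_eq_inner_mul_inner (hrank x))⟩,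
    (Measurable.find hw hpm hp).subtype_mk, hrank⟩

theorem IsState.exists_measure_closedBall {A : Type*} [CStarAlgebra A] {ω : A →ₗ[ℂ] ℂ}
    (hω : IsState ω) {T : H → H → A} (hT : IsRankOneForm T) :
    ∃ μ : Measure (Metric.closedBall (0 : H) 1), IsProbabilityMeasure μ ∧ ∀ (k : ℕ) (f g : H),
      ω (T f g ^ k)
        = ∫ u : Metric.closedBall (0 : H) 1, (⟪g, (u : H)⟫_ℂ * ⟪(u : H), f⟫_ℂ) ^ k ∂μ := by
  have := UniformSpace.secondCountable_of_separable H
  obtain ⟨C, _, ι, hι, hrange⟩ := exists_commCStarAlgebra_of_commute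
    (s := Set.range fun p : H × H => T p.1 p.2)
    (by rintro _ ⟨p, rfl⟩ _ ⟨q, rfl⟩; exact hT.mul_comm _ _ _ _)
    (by rintro _ ⟨p, rfl⟩; exact ⟨(p.2, p.1), (hT.star_apply _ _).symm⟩)
  choose T' hT' using show ∀ f g, ∃ c, ι c = T f g from fun f g => hrange ⟨(f, g), rfl⟩
  have hform : IsRankOneForm T' := .of_map hι (by simpa only [hT'] using hT)
  let _ : MeasurableSpace (WeakDual.characterSpace ℂ C) := borel _
  have _ : BorelSpace (WeakDual.characterSpace ℂ C) := ⟨rfl⟩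
  obtain ⟨ν, _, hν⟩ := (hω.comp ι).exists_measure_characterSpace
  obtain ⟨u, hu, hTu⟩ := IsRankOneForm.exists_measurable
    (z := fun (φ : WeakDual.characterSpace ℂ C) f g => φ (T' f g)) (fun φ => hform.map φ)
    fun f g => (WeakDual.gelfandTransform ℂ C (T' f g)).continuous.measurable
  refine ⟨ν.map u, Measure.isProbabilityMeasure_map hu.aemeasurable, fun k f g => ?_⟩
  rw [integral_map hu.aemeasurable (by fun_prop)]
  calc ω (T f g ^ k) = ω (ι (T' f g ^ k)) := by rw [map_pow ι, hT']
    _ = ∫ φ : WeakDual.characterSpace ℂ C, φ (T' f g ^ k) ∂ν := hν _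
    _ = ∫ φ, (⟪g, (u φ : H)⟫_ℂ * ⟪(u φ : H), f⟫_ℂ) ^ k ∂ν := by simp only [map_pow, hTu]

end Selection

/-! ### The limit of the one-body operators -/

section WeakStar

theorem isCompactOperator_rankOne {𝕜 E F : Type*} [RCLike 𝕜] [SeminormedAddCommGroup E]
    [NormedSpace 𝕜 E] [SeminormedAddCommGroup F] [InnerProductSpace 𝕜 F] (x : E) (y : F) :
    IsCompactOperator (InnerProductSpace.rankOne 𝕜 x y) :=
  (isCompactOperator_of_locallyCompactSpace_rng (ContinuousLinearMap.toSpanSingleton 𝕜 x)).comp_clm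
    (innerSL 𝕜 y)

variable {E : Type*} [NormedAddCommGroup E] [InnerProductSpace ℂ E] [CompleteSpace E]

theorem trace_comp_rankOne (A : E →L[ℂ] E) (x y : E) :
    trace (A ∘L InnerProductSpace.rankOne ℂ x y) = ⟪y, A x⟫_ℂ := by
  rw [trace, ← (someBasis E).tsum_inner_mul_inner]
  refine tsum_congr fun i => ?_
  rw [ContinuousLinearMap.comp_apply, InnerProductSpace.rankOne_apply, map_smul, inner_smul_right]

theorem TendstoWeakStar.tendsto_inner {X : Type*} {T : X → E →L[ℂ] E} {l : Filter X}
    {S : E →L[ℂ] E} (h : TendstoWeakStar T l S) (x y : E) :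
    Tendsto (fun i => ⟪y, T i x⟫_ℂ) l (𝓝 ⟪y, S x⟫_ℂ) := by
  simpa only [trace_comp_rankOne] using h _ (isCompactOperator_rankOne x y)

end WeakStar

section OneBodyLimit

open scoped ENNReal

universe u

variable {H : Type u} [NormedAddCommGroup H] [InnerProductSpace ℂ H]

/-- The sequence of the operators `oneBody f g N`, as an element of the product C*-algebra. -/
noncomputable def oneBodySeq (f g : H) : lp (fun N => SymPow H N →L[ℂ] SymPow H N) ∞ :=
  ⟨fun N => oneBody f g N, memℓp_infty ⟨‖f‖ * ‖g‖, by
    rintro _ ⟨N, rfl⟩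
    exact norm_oneBody_le f g N⟩⟩

theorem isRankOneForm_oneBodySeq [CompleteSpace H]
    [∀ N, Nontrivial (SymPow H N →L[ℂ] SymPow H N)] {A : Type*} [CStarAlgebra A]
    {π : lp (fun N => SymPow H N →L[ℂ] SymPow H N) ∞ →⋆ₐ[ℂ] A}
    (hπ : ∀ x : lp (fun N => SymPow H N →L[ℂ] SymPow H N) ∞,
      Tendsto (fun N => ‖x N‖) atTop (𝓝 0) → π x = 0) :
    IsRankOneForm fun f g : H => π (oneBodySeq f g) where
  add_left f f' g := by
    rw [← map_add]
    exact congrArg π (lp.ext (funext fun N => oneBody_add f f' g N))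
  smul_left c f g := by
    rw [← map_smul]
    exact congrArg π (lp.ext (funext fun N => oneBody_smul c f g N))
  star_apply f g := by
    rw [← map_star]
    exact congrArg π (lp.ext (funext fun N => adjoint_oneBody f g N))
  exchange f g f' g' := by
    rw [← sub_eq_zero, ← map_mul, ← map_mul, ← map_sub]
    exact hπ _ (tendsto_norm_oneBody_exchange f g f' g')
  norm_le f g := (NonUnitalStarAlgHom.norm_apply_le π _).trans
    (lp.norm_le_of_forall_le (by positivity) (norm_oneBody_le f g))
  norm_sub_le f := by
    rw [← map_one π, ← map_smul, ← map_sub]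
    exact (NonUnitalStarAlgHom.norm_apply_le π _).trans
      (lp.norm_le_of_forall_le (by positivity) (norm_smul_one_sub_oneBody_le f))

variable [CompleteSpace H]

theorem tendsto_expectation_oneBody_pow {S : ∀ N : ℕ, SymPow H N →L[ℂ] SymPow H N}
    (hS : ∀ N, HasSum (fun i => ‖(S N).adjoint (someBasis (SymPow H N) i)‖ ^ 2) 1)
    {k : ℕ} {γ : SymPow H k →L[ℂ] SymPow H k}
    (hγ : TendstoWeakStar
      (fun m => reducedDensityMatrix k m ((S (k + m)).adjoint ∘L S (k + m))) atTop γ) (f g : H) :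
    Tendsto (fun N => expectation _ (hS N).summable (oneBody f g N ^ k)) atTop
      (𝓝 ⟪powTensor g k, γ (powTensor f k)⟫_ℂ) := by
  let moment (N : ℕ) : ℂ := expectation _ (hS N).summable (kBody f g k N)
  have hmoment : Tendsto moment atTop (𝓝 ⟪powTensor g k, γ (powTensor f k)⟫_ℂ) := by
    refine (tendsto_add_atTop_iff_nat k).mp ((hγ.tendsto_inner _ _).congr fun m => ?_)
    rw [inner_powTensor_reducedDensityMatrix _ (hS (k + m)).summable, Nat.add_comm m k]
    rfl
  have hdiff : Tendsto (fun N => expectation _ (hS N).summable (oneBody f g N ^ k) - moment N) atTop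
      (𝓝 0) :=
    squeeze_zero_norm (fun N => by
      rw [← map_sub]
      exact (isState_expectation (hS N)).norm_apply_le _)
      (tendsto_norm_oneBody_pow_sub_kBody f g k)
  simpa only [sub_add_cancel, zero_add] using hdiff.add hmoment

theorem exists_isState_isRankOneForm {Γ : ∀ N : ℕ, SymPow H N →L[ℂ] SymPow H N}
    (hΓ : ∀ N, IsBosonicState (Γ N)) {γ : ∀ k : ℕ, SymPow H k →L[ℂ] SymPow H k}
    (hγ : ∀ k, TendstoWeakStar
      (fun m => reducedDensityMatrix k m (Γ (k + m))) atTop (γ k)) :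
    ∃ (A : Type u) (_ : CStarAlgebra A) (ω : A →ₗ[ℂ] ℂ) (T : H → H → A), IsState ω ∧
      IsRankOneForm T ∧ ∀ k f g, ω (T f g ^ k) = ⟪powTensor g k, γ k (powTensor f k)⟫_ℂ := by
  choose S hS hsum using fun N => (hΓ N).exists_eq_adjoint_comp
  obtain rfl : Γ = fun N => (S N).adjoint ∘L S N := funext hS
  have hstate := fun N => isState_expectation (hsum N)
  have := fun N => (hstate N).nontrivial
  obtain ⟨A, _, π, ω, hω, hπ, hlim⟩ := IsState.exists_limit hstate atTop
  refine ⟨A, inferInstance, ω, fun f g => π (oneBodySeq f g), hω, isRankOneForm_oneBodySeq hπ,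
    fun k f g => ?_⟩
  rw [← map_pow]
  exact hlim _ _ (tendsto_expectation_oneBody_pow hsum (hγ k) f g)

end OneBodyLimit

/-! ### Averaging over a group -/

section OrbitAverage

theorem exists_probabilityMeasure_isMulLeftInvariant (G : Type*) [Group G] [TopologicalSpace G]
    [IsTopologicalGroup G] [CompactSpace G] [MeasurableSpace G] [BorelSpace G] :
    ∃ m : Measure G, IsProbabilityMeasure m ∧ m.IsMulLeftInvariant :=
  ⟨Measure.haarMeasure ⊤, ⟨Measure.haarMeasure_self⟩, inferInstance⟩

variable {G X : Type*} [MeasurableSpace G] [MeasurableSpace X]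

/-- The average `∫ (z • μ) dm(z)` of the translates of `μ` with respect to a measure `m` on the
group `G`. -/
noncomputable def orbitAverage [SMul G X] (m : Measure G) (μ : Measure X) : Measure X :=
  (m.prod μ).map fun p => p.1 • p.2

theorem isProbabilityMeasure_orbitAverage [SMul G X] [MeasurableSMul₂ G X] (m : Measure G)
    (μ : Measure X) [IsProbabilityMeasure m] [IsProbabilityMeasure μ] :
    IsProbabilityMeasure (orbitAverage m μ) :=
  Measure.isProbabilityMeasure_map measurable_smul.aemeasurable

theorem integral_orbitAverage [SMul G X] [MeasurableSMul₂ G X] {E : Type*} [NormedAddCommGroup E]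
    [NormedSpace ℝ E] (m : Measure G) (μ : Measure X) [IsProbabilityMeasure m] [SFinite μ]
    {F : X → E} (hF : StronglyMeasurable F) (hinv : ∀ (z : G) x, F (z • x) = F x) :
    ∫ x, F x ∂orbitAverage m μ = ∫ x, F x ∂μ :=
  calc ∫ x, F x ∂orbitAverage m μ = ∫ p : G × X, F (p.1 • p.2) ∂m.prod μ :=
        integral_map measurable_smul.aemeasurable hF.aestronglyMeasurable
    _ = ∫ p : G × X, F p.2 ∂m.prod μ := by simp only [hinv]
    _ = ∫ x, F x ∂μ := by rw [integral_fun_snd, probReal_univ, one_smul]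

theorem map_smul_orbitAverage [Group G] [MeasurableMul₂ G] [MulAction G X] [MeasurableSMul₂ G X]
    (m : Measure G) (μ : Measure X) [SFinite m] [SFinite μ] [m.IsMulLeftInvariant] (z : G) :
    (orbitAverage m μ).map (fun x => z • x) = orbitAverage m μ := by
  have hsmul : Measurable fun p : G × X => p.1 • p.2 := measurable_smul
  have htranslate := (measurePreserving_mul_left m z).prod (MeasurePreserving.id μ)
  rw [orbitAverage, Measure.map_map (measurable_const_smul z) hsmul]
  conv_rhs => rw [← htranslate.map_eq, Measure.map_map hsmul htranslate.measurable]
  exact congrArg (Measure.map · _) (funext fun p => (mul_smul z p.1 p.2).symm)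

end OrbitAverage

/-! ### Measures on the unit ball -/

section UnitBall

open Metric

variable {H : Type*} [NormedAddCommGroup H] [InnerProductSpace ℂ H]

theorem inner_mul_inner_sphere_smul (z : sphere (0 : ℂ) 1) (u : closedBall (0 : H) 1) (f g : H) :
    ⟪g, ((z • u : closedBall (0 : H) 1) : H)⟫_ℂ * ⟪((z • u : closedBall (0 : H) 1) : H), f⟫_ℂ
      = ⟪g, (u : H)⟫_ℂ * ⟪(u : H), f⟫_ℂ := by
  have hcoe : ((z • u : closedBall (0 : H) 1) : H) = (z : ℂ) • (u : H) := rfl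
  have hz : (z : ℂ) * conj (z : ℂ) = 1 := by
    rw [Complex.mul_conj', mem_sphere_zero_iff_norm.mp z.2, Complex.ofReal_one, one_pow]
  rw [hcoe, inner_smul_left, inner_smul_right]
  linear_combination (⟪g, (u : H)⟫_ℂ * ⟪(u : H), f⟫_ℂ) * hz

theorem exists_sphere_pow_mul_conj_pow_eq_neg_one {j l : ℕ} (hjl : j ≠ l) :
    ∃ z : sphere (0 : ℂ) 1, (z : ℂ) ^ j * conj (z : ℂ) ^ l = -1 := by
  have hsub : (j : ℂ) - l ≠ 0 := sub_ne_zero.mpr (Nat.cast_injective.ne hjl)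
  let θ : ℝ := Real.pi / (j - l)
  refine ⟨⟨Complex.exp (θ * Complex.I), by
    rw [mem_sphere_zero_iff_norm, Complex.norm_exp_ofReal_mul_I]⟩, ?_⟩
  rw [← Complex.exp_conj, map_mul, Complex.conj_ofReal, Complex.conj_I, ← Complex.exp_nat_mul,
    ← Complex.exp_nat_mul, ← Complex.exp_add, ← Complex.exp_pi_mul_I]
  congr 1
  simp only [θ, Complex.ofReal_div, Complex.ofReal_sub, Complex.ofReal_natCast]
  field_simp
  ring

variable [TopologicalSpace.SeparableSpace H] [MeasurableSpace H] [BorelSpace H]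

theorem integrable_rankOne_powTensor (μ : Measure (closedBall (0 : H) 1)) [IsFiniteMeasure μ]
    (k : ℕ) : Integrable (fun u : closedBall (0 : H) 1 =>
      InnerProductSpace.rankOne ℂ (powTensor (u : H) k) (powTensor (u : H) k)) μ := by
  have := UniformSpace.secondCountable_of_separable H
  have hpow : Continuous fun u : closedBall (0 : H) 1 => powTensor (u : H) k :=
    differentiable_powTensor.continuous.comp continuous_subtype_val
  refine .of_bound (C := 1) (Continuous.aestronglyMeasurable ?_) (Eventually.of_forall fun u => ?_)
  · exact ((ContinuousLinearMap.smulRightL ℂ (SymPow H k) (SymPow H k)).continuous.comp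
      ((innerSL ℂ).continuous.comp hpow)).clm_apply hpow
  · have hle := pow_le_one₀ (n := k) (norm_nonneg _) (mem_closedBall_zero_iff.mp u.2)
    rw [InnerProductSpace.norm_rankOne, norm_powTensor]
    exact mul_le_one₀ hle (by positivity) hle

theorem inner_integral_rankOne_powTensor (μ : Measure (closedBall (0 : H) 1)) [IsFiniteMeasure μ]
    {k : ℕ} (x y : SymPow H k) :
    ⟪x, (∫ u : closedBall (0 : H) 1,
        InnerProductSpace.rankOne ℂ (powTensor (u : H) k) (powTensor (u : H) k) ∂μ) y⟫_ℂ
      = ∫ u : closedBall (0 : H) 1, ⟪x, powTensor (u : H) k⟫_ℂ * ⟪powTensor (u : H) k, y⟫_ℂ ∂μ := by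
  have hcomm := (innerSL ℂ x ∘L ContinuousLinearMap.apply ℂ _ y).integral_comp_comm
    (integrable_rankOne_powTensor μ k)
  simpa only [ContinuousLinearMap.comp_apply, ContinuousLinearMap.apply_apply, innerSL_apply_apply,
    InnerProductSpace.inner_right_rankOne_apply] using hcomm.symm

theorem integral_prod_inner_mul_prod_inner (μ : Measure (closedBall (0 : H) 1))
    [IsFiniteMeasure μ] {k : ℕ} (g h : Fin k → H) :
    ∫ u : closedBall (0 : H) 1, (∏ i, ⟪g i, (u : H)⟫_ℂ) * ∏ i, ⟪(u : H), h i⟫_ℂ ∂μ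
      = ⟪(symIncl H k).adjoint (tprod g), (∫ u : closedBall (0 : H) 1,
          InnerProductSpace.rankOne ℂ (powTensor (u : H) k) (powTensor (u : H) k) ∂μ)
            ((symIncl H k).adjoint (tprod h))⟫_ℂ := by
  rw [inner_integral_rankOne_powTensor]
  simp only [ContinuousLinearMap.adjoint_inner_left, ContinuousLinearMap.adjoint_inner_right,
    symIncl_powTensor, inner_tprod]

theorem exists_phase_invariant_measure (μ : Measure (closedBall (0 : H) 1))
    [IsProbabilityMeasure μ] :
    ∃ ν : ProbabilityMeasure (closedBall (0 : H) 1),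
      (∀ z : sphere (0 : ℂ) 1, (ν : Measure (closedBall (0 : H) 1)).map (fun u => z • u) = ν) ∧
      ∀ (k : ℕ) (f g : H), ∫ u : closedBall (0 : H) 1, (⟪g, (u : H)⟫_ℂ * ⟪(u : H), f⟫_ℂ) ^ k ∂ν
        = ∫ u : closedBall (0 : H) 1, (⟪g, (u : H)⟫_ℂ * ⟪(u : H), f⟫_ℂ) ^ k ∂μ := by
  have := UniformSpace.secondCountable_of_separable H
  obtain ⟨m, _, _⟩ := exists_probabilityMeasure_isMulLeftInvariant (sphere (0 : ℂ) 1)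
  refine ⟨⟨orbitAverage m μ, isProbabilityMeasure_orbitAverage m μ⟩, map_smul_orbitAverage m μ,
    fun k f g => integral_orbitAverage m μ ?_ fun z u => by rw [inner_mul_inner_sphere_smul]⟩
  exact Continuous.stronglyMeasurable (by fun_prop)

end UnitBall

section Uniqueness

open Metric

variable {H : Type*} [NormedAddCommGroup H] [InnerProductSpace ℂ H]

open scoped BoundedContinuousFunction in
/-- The coordinate function `u ↦ ⟪g, u⟫` on the unit ball. -/
noncomputable def coordinate (g : H) : closedBall (0 : H) 1 →ᵇ ℂ :=
  .ofNormedAddCommGroup (fun u => ⟪g, (u : H)⟫_ℂ) (by fun_prop) ‖g‖ fun u =>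
    (norm_inner_le_norm _ _).trans
      (mul_le_of_le_one_right (norm_nonneg _) (mem_closedBall_zero_iff.mp u.2))

theorem coordinate_apply (g : H) (u : closedBall (0 : H) 1) : coordinate g u = ⟪g, (u : H)⟫_ℂ := rfl

open scoped BoundedContinuousFunction in
theorem exists_eq_prod_of_mem_closure_coordinate {F : closedBall (0 : H) 1 →ᵇ ℂ}
    (hF : F ∈ Submonoid.closure (Set.range (coordinate (H := H)) ∪ star (Set.range coordinate))) :
    ∃ (j l : ℕ) (g : Fin j → H) (h : Fin l → H),
      ∀ u, F u = (∏ i, ⟪g i, (u : H)⟫_ℂ) * ∏ i, ⟪(u : H), h i⟫_ℂ := by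
  induction hF using Submonoid.closure_induction with
  | mem F hF =>
    rcases hF with ⟨g, rfl⟩ | ⟨g, hg⟩
    · exact ⟨1, 0, fun _ => g, Fin.elim0, fun u => by simp [coordinate_apply]⟩
    · refine ⟨0, 1, Fin.elim0, fun _ => g, fun u => ?_⟩
      rw [← star_star F, ← hg, BoundedContinuousFunction.star_apply, coordinate_apply]
      simp
  | one => exact ⟨0, 0, Fin.elim0, Fin.elim0, fun u => by simp⟩
  | mul F F' _ _ hF hF' =>
    obtain ⟨j, l, g, h, hF⟩ := hF
    obtain ⟨j', l', g', h', hF'⟩ := hF'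
    refine ⟨j + j', l + l', Fin.append g g', Fin.append h h', fun u => ?_⟩
    simp only [BoundedContinuousFunction.coe_mul, Pi.mul_apply, hF, hF', Fin.prod_univ_add,
      Fin.append_left, Fin.append_right]
    ring

theorem separatesPoints_adjoin_coordinate :
    ((StarAlgebra.adjoin ℂ (Set.range (coordinate (H := H)))).map
      (BoundedContinuousFunction.toContinuousMapStarₐ ℂ)).SeparatesPoints := by
  intro u v huv
  obtain ⟨g, hg⟩ : ∃ g : H, ⟪g, (u : H)⟫_ℂ ≠ ⟪g, (v : H)⟫_ℂ := by
    by_contra! heq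
    exact huv (Subtype.ext (ext_inner_left ℂ heq))
  exact ⟨_, ⟨_, ⟨coordinate g, StarAlgebra.subset_adjoin ℂ _ ⟨g, rfl⟩, rfl⟩, rfl⟩, hg⟩

variable [TopologicalSpace.SeparableSpace H] [MeasurableSpace H] [BorelSpace H]

theorem integral_prod_inner_eq_zero_of_ne {μ : Measure (closedBall (0 : H) 1)}
    (hμ : ∀ z : sphere (0 : ℂ) 1, μ.map (fun u => z • u) = μ) {j l : ℕ} (hjl : j ≠ l)
    (g : Fin j → H) (h : Fin l → H) :
    ∫ u : closedBall (0 : H) 1, (∏ i, ⟪g i, (u : H)⟫_ℂ) * ∏ i, ⟪(u : H), h i⟫_ℂ ∂μ = 0 := by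
  have := UniformSpace.secondCountable_of_separable H
  obtain ⟨z, hz⟩ := exists_sphere_pow_mul_conj_pow_eq_neg_one hjl
  let F (u : closedBall (0 : H) 1) : ℂ := (∏ i, ⟪g i, (u : H)⟫_ℂ) * ∏ i, ⟪(u : H), h i⟫_ℂ
  have hF : Continuous F := by fun_prop
  have hrotate (u) : F (z • u) = -F u := by
    have hcoe : ((z • u : closedBall (0 : H) 1) : H) = (z : ℂ) • (u : H) := rfl
    simp only [F, hcoe, inner_smul_left, inner_smul_right, Finset.prod_mul_distrib,
      Finset.prod_const, Finset.card_univ, Fintype.card_fin]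
    linear_combination ((∏ i, ⟪g i, (u : H)⟫_ℂ) * ∏ i, ⟪(u : H), h i⟫_ℂ) * hz
  refine self_eq_neg.mp ?_
  calc ∫ u, F u ∂μ = ∫ u, F u ∂μ.map (fun u => z • u) := by rw [hμ]
    _ = ∫ u, F (z • u) ∂μ :=
      integral_map (measurable_const_smul z).aemeasurable hF.aestronglyMeasurable
    _ = -∫ u, F u ∂μ := by simp only [hrotate, integral_neg]

variable [CompleteSpace H]

theorem ext_of_integral_rankOne_powTensor_eq {μ ν : Measure (closedBall (0 : H) 1)}
    [IsFiniteMeasure μ] [IsFiniteMeasure ν]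
    (hμ : ∀ z : sphere (0 : ℂ) 1, μ.map (fun u => z • u) = μ)
    (hν : ∀ z : sphere (0 : ℂ) 1, ν.map (fun u => z • u) = ν)
    (h : ∀ k : ℕ,
      ∫ u : closedBall (0 : H) 1,
        InnerProductSpace.rankOne ℂ (powTensor (u : H) k) (powTensor (u : H) k) ∂μ
      = ∫ u : closedBall (0 : H) 1,
        InnerProductSpace.rankOne ℂ (powTensor (u : H) k) (powTensor (u : H) k) ∂ν) : μ = ν := by
  have := UniformSpace.secondCountable_of_separable H
  have : CompleteSpace (closedBall (0 : H) 1) := isClosed_closedBall.completeSpace_coe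
  refine ext_of_forall_mem_subalgebra_integral_eq_of_pseudoEMetric_complete_countable
    separatesPoints_adjoin_coordinate fun F hF => ?_
  replace hF := (StarAlgebra.adjoin_eq_span (R := ℂ) (Set.range (coordinate (H := H)))).le hF
  induction hF using Submodule.span_induction with
  | mem F hF =>
    obtain ⟨j, l, g, h', hprod⟩ := exists_eq_prod_of_mem_closure_coordinate hF
    simp only [hprod]
    rcases eq_or_ne j l with rfl | hjl
    · rw [integral_prod_inner_mul_prod_inner, integral_prod_inner_mul_prod_inner, h]
    · rw [integral_prod_inner_eq_zero_of_ne hμ hjl, integral_prod_inner_eq_zero_of_ne hν hjl]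
  | zero => simp
  | add F F' _ _ hF hF' =>
    simp only [BoundedContinuousFunction.coe_add, Pi.add_apply]
    rw [integral_add (F.integrable μ) (F'.integrable μ),
      integral_add (F.integrable ν) (F'.integrable ν), hF, hF']
  | smul c F _ hF => simp only [BoundedContinuousFunction.coe_smul, integral_smul, hF]

end Uniqueness

end DeFinetti

theorem mainTheorem2 {H : Type*} [NormedAddCommGroup H] [InnerProductSpace ℂ H] [CompleteSpace H]
    [TopologicalSpace.SeparableSpace H] [MeasurableSpace H] [BorelSpace H]
    (Γ : ∀ N : ℕ, DeFinetti.SymPow H N →L[ℂ] DeFinetti.SymPow H N)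
    (hΓ : ∀ N, DeFinetti.IsBosonicState (Γ N))
    (γ : ∀ k : ℕ, DeFinetti.SymPow H k →L[ℂ] DeFinetti.SymPow H k)
    (hγ : ∀ k, DeFinetti.IsTraceClass (γ k))
    (hconv : ∀ k : ℕ, DeFinetti.TendstoWeakStar
      (fun m : ℕ => DeFinetti.reducedDensityMatrix k m (Γ (k + m))) atTop (γ k)) :
    ∃! μ : ProbabilityMeasure (Metric.closedBall (0 : H) 1),
      (∀ z : Metric.sphere (0 : ℂ) 1,
        (μ : Measure (Metric.closedBall (0 : H) 1)).map (fun u => z • u) = μ) ∧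
      ∀ k : ℕ,
        Integrable (fun u : Metric.closedBall (0 : H) 1 =>
          InnerProductSpace.rankOne ℂ (DeFinetti.powTensor (u : H) k)
            (DeFinetti.powTensor (u : H) k)) (μ : Measure (Metric.closedBall (0 : H) 1)) ∧
        γ k = ∫ u : Metric.closedBall (0 : H) 1,
          InnerProductSpace.rankOne ℂ (DeFinetti.powTensor (u : H) k)
            (DeFinetti.powTensor (u : H) k) ∂(μ : Measure (Metric.closedBall (0 : H) 1)) := by
  refine existsUnique_of_exists_of_unique ?existence ?uniqueness
  case existence =>
    obtain ⟨A, _, ω, T, hω, hT, hmoment⟩ := DeFinetti.exists_isState_isRankOneForm hΓ hconv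
    obtain ⟨μ₀, _, hμ₀⟩ := hω.exists_measure_closedBall hT
    obtain ⟨μ, hinvariant, hμ⟩ := DeFinetti.exists_phase_invariant_measure μ₀
    refine ⟨μ, hinvariant, fun k => ⟨DeFinetti.integrable_rankOne_powTensor _ k,
      DeFinetti.clm_ext_inner_powTensor fun f g => ?_⟩⟩
    rw [DeFinetti.inner_integral_rankOne_powTensor, ← hmoment, hμ₀, ← hμ]
    simp only [DeFinetti.inner_powTensor, mul_pow]
  case uniqueness =>
    rintro μ ν ⟨hμ, hμγ⟩ ⟨hν, hνγ⟩
    exact ProbabilityMeasure.toMeasure_injective <|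
      DeFinetti.ext_of_integral_rankOne_powTensor_eq hμ hν fun k =>
        (hμγ k).2.symm.trans (hνγ k).2
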